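/- **Definitions.** Let $\mathfrak B$ be a family of complex Banach spaces. It is *uniformly convex* if for every $\varepsilon>0$ there is $\delta>0$ such that $1-\|\xi+\eta\|/2\ge\delta$ for all $B\in\mathfrak B$ and all unit vectors $\xi,\eta\in B$ with $\|\xi-\eta\|\ge\varepsilon$. A *length function* on a group $\Gamma$ is a map $\ell:\Gamma\to[0,\infty)$ with $\ell(e)=0$, $\ell(g^{-1})=\ell(g)$ and $\ell(gh)\le\ell(g)+\ell(h)$; it is *proper* if $\{g:\ell(g)\le R\}$ is finite for every $R$. *Groups.* For a length function $\ell$ on $\Gamma$ and $s,c>0$, let $\mathcal C_{\ell,s,c}(\Gamma)$ be the completion of the group algebra $\mathbb C\Gamma$ in the norm $\|f\|=\sup_\pi\|\pi(f)\|$, where $\pi$ runs over all representations of $\Gamma$ by bounded operators on spaces $B\in\mathfrak B$ with $\|\pi(\gamma)\|\le c\,e^{s\ell(\gamma)}$ for all $\gamma\in\Gamma$. The group $\Gamma$ has *strong Banach property (T)* for $\mathfrak B$ if for every length function $\ell$ there is $s>0$ such that for every $c>0$ the algebra $\mathcal C_{\ell,s,c}(\Gamma)$ contains a *Kazhdan projection*: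 an idempotent $p=p^*$ such that for each of these $\pi$ the operator $\pi(p)$ is a projection onto the subspace of $\Gamma$-invariant vectors. The involution is the continuous extension of $f^*(\gamma)=\overline{f(\gamma^{-1})}$. *Spaces.* Let $(X,d)$ be an extended metric space of bounded geometry ($\sup_x\#\{y : d(x,y)\le R\}<\infty$ for every $R<\infty$), and let $\mathbb C_u[X]$ be the algebra of complex $X\times X$ matrices $T$ with bounded entries and finite propagation $\sup\{d(x,y):T_{xy}\ne0\}$. A *partial translation* is a $0$-$1$ matrix $V\in\mathbb C_u[X]$ with at most one nonzero entry in each row and each column; $R_V$ is the set of the $x$ with $V_{xy}\neq 0$ for some $y$. An extended (pseudo)metric $\delta$ on $X$ is *finer* than $d$ if for each $R<\infty$ it is bounded on $\{(x,y) : d(x,y)\le R\}$; put $\mathrm{prop}_\delta(T)=\sup\{\delta(x,y):T_{xy}\ne0\}$. Let $\mathcal C_{\delta,s,c}(X)$ be the completion of $\mathbb C_u[X]$ in the seminorm $\|T\|=\sup_\pi\|\pi(T)\|$, where $\pi$ runs over all unital representations of $\mathbb C_u[X]$ on spaces $B\in\mathfrak B$ that are bounded on the diagonal subalgebra $\ell^\infty(X)$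 and satisfy $\|\pi(V)\|\le c\,e^{s\,\mathrm{prop}_\delta(V)}$ for all partial translations $V$. For a set $\mathcal D$ of metrics finer than $d$, the space $X$ has *geometric strong Banach property (T)* for $\mathfrak B$ and $\mathcal D$ if for every $\delta\in\mathcal D$ there is $s>0$ such that for every $c>0$ the algebra $\mathcal C_{\delta,s,c}(X)$ contains an idempotent $p=p^*$ such that for each of these $\pi$ the operator $\pi(p)$ is a projection onto $\{\xi\in B:\pi(V)\xi=\pi(\chi_{R_V})\xi\text{ for all partial translations }V\}$. The involution is the continuous extension of the conjugate transpose. *Box spaces.* A *box space* of a countable residually finite group $\Gamma$ is a disjoint union $X=\bigsqcup_n\Gamma/N_n$, where $N_1\supseteq N_2\supseteq\cdots$ are normal subgroups of finite index with trivial intersection, with distance $\infty$ between different quotients and, on each $\Gamma/N_n$, the quotient metric of the right invariant metric $(g,h)\mapsto\ell_0(gh^{-1})$ for some proper length function $\ell_0$ on $\Gamma$ that vanishes only at $e$. In the same way every length function $\ell$ on $\Gamma$ determines an extended (pseudo)metric $\delta_\ell$ on $X$, which is finer than the metric of $X$. Let $\mathcal D_\ell$ be the set of all $\delta_\ell$,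 for all length functions $\ell$ on $\Gamma$. **Theorem.** Let $\mathfrak B$ be a uniformly convex family of complex Banach spaces which, up to isometric isomorphism, is closed under duality, under complex conjugation, under ultraproducts of sequences along non-principal ultrafilters on $\mathbb N$, and under $B\mapsto L^2(\mu,B)$ for every measure space. Let $\Gamma$ be a countable discrete residually finite group. The following are equivalent: 1. $\Gamma$ has strong Banach property (T) for $\mathfrak B$; 2. every box space of $\Gamma$ has geometric strong Banach property (T) for $\mathfrak B$ and $\mathcal D_\ell$; 3. some box space of $\Gamma$ has geometric strong Banach property (T) for $\mathfrak B$ and $\mathcal D_\ell$. -/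

import Mathlib

open scoped ENNReal NNReal

noncomputable section

namespace GeomT

universe u v w

/-! ## Families of complex Banach spaces -/

/-- A complex Banach space, bundled. -/
structure BanachSp where
  carrier : Type u
  [normedAddCommGroup : NormedAddCommGroup carrier]
  [normedSpace : NormedSpace ℂ carrier]
  [completeSpace : CompleteSpace carrier]

instance : CoeSort BanachSp.{u} (Type u) := ⟨BanachSp.carrier⟩

attribute [instance] BanachSp.normedAddCommGroup BanachSp.normedSpace BanachSp.completeSpace

/-- The algebra `L(B)` of bounded operators. -/
abbrev BanachSp.Op (B : BanachSp.{u}) : Type u := B.carrier →L[ℂ] B.carrier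

/-- The modulus of convexity of the family is strictly positive. -/
def UniformlyConvexFamily (𝔅 : Set BanachSp.{u}) : Prop :=
  ∀ ε : ℝ, 0 < ε → ∃ δ : ℝ, 0 < δ ∧ ∀ B ∈ 𝔅, ∀ ξ η : B.carrier,
    ‖ξ‖ = 1 → ‖η‖ = 1 → ε ≤ ‖ξ - η‖ → δ ≤ 1 - ‖ξ + η‖ / 2

/-- The dual of a member is (isometrically isomorphic to) a member. -/
def ClosedUnderDuality (𝔅 : Set BanachSp.{u}) : Prop :=
  ∀ B ∈ 𝔅, ∃ C ∈ 𝔅, Nonempty (C.carrier ≃ₗᵢ[ℂ] StrongDual ℂ B.carrier)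

/-- The complex conjugate of a member is a member: the conjugate of `B` is, up to linear isometry,
the Banach space that admits a conjugate linear isometric bijection onto `B`. -/
def ClosedUnderConjugation (𝔅 : Set BanachSp.{u}) : Prop :=
  ∀ B ∈ 𝔅, ∃ C ∈ 𝔅, Nonempty (C.carrier ≃ₛₗᵢ[starRingEnd ℂ] B.carrier)

/-- The bounded sequences `(ξₙ)`, `ξₙ ∈ Eₙ`, with `lim_{n → ω} ‖ξₙ‖ = 0`. -/
def ultraNull (E : ℕ → BanachSp.{u}) (ω : Ultrafilter ℕ) :
    Submodule ℂ (lp (fun n => (E n).carrier) ∞) where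
  carrier := {ξ | Filter.Tendsto (fun n => ‖ξ n‖) ω (nhds 0)}
  add_mem' {a b} ha hb := by
    refine squeeze_zero (fun n => norm_nonneg _) (fun n => ?_) (by simpa using ha.add hb)
    simpa using norm_add_le (a n) (b n)
  zero_mem' := by simp
  smul_mem' c a ha := by
    have h : Filter.Tendsto (fun n => ‖c‖ * ‖a n‖) ω (nhds (‖c‖ * 0)) := ha.const_mul ‖c‖
    simpa [norm_smul] using h

/-- The Banach space ultraproduct of the sequence `E` along `ω`, with the quotient norm. -/
abbrev Ultraproduct (E : ℕ → BanachSp.{u}) (ω : Ultrafilter ℕ) : Type u :=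
  lp (fun n => (E n).carrier) ∞ ⧸ ultraNull E ω

/-- Ultraproducts of sequences of members along non-principal ultrafilters on `ℕ` are members. -/
def ClosedUnderUltraproducts (𝔅 : Set BanachSp.{u}) : Prop :=
  ∀ E : ℕ → BanachSp.{u}, (∀ n, E n ∈ 𝔅) → ∀ ω : Ultrafilter ℕ, (∀ n : ℕ, ω ≠ pure n) →
    ∃ C ∈ 𝔅, Nonempty (C.carrier ≃ₗᵢ[ℂ] Ultraproduct E ω)

/-- `L²(μ, B)` is a member for every member `B` and every measure space. -/
def ClosedUnderL2 (𝔅 : Set BanachSp.{u}) : Prop :=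
  ∀ B ∈ 𝔅, ∀ (Ω : Type u) [MeasurableSpace Ω] (μ : MeasureTheory.Measure Ω),
    ∃ C ∈ 𝔅, Nonempty (C.carrier ≃ₗᵢ[ℂ] MeasureTheory.Lp B.carrier 2 μ)

/-! ## The Banach algebra defined by a class of representations -/

/-- A class of unital representations of `A` on Banach spaces such that every element of `A` is
uniformly bounded in all of them. -/
structure RepClass (A : Type w) [Ring A] [Algebra ℂ A] where
  Mem : (B : BanachSp.{u}) → (A →ₐ[ℂ] B.Op) → Prop
  bounded : ∀ a : A, ∃ C : ℝ, ∀ (B : BanachSp.{u}) (π : A →ₐ[ℂ] B.Op), Mem B π → ‖π a‖ ≤ C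

namespace RepClass

variable {A : Type w} [Ring A] [Algebra ℂ A] (R : RepClass.{u, w} A)

/-- The values `‖π(a)‖`, for `π` in the class. -/
def values (a : A) : Set ℝ :=
  {r | ∃ (B : BanachSp.{u}) (π : A →ₐ[ℂ] B.Op), R.Mem B π ∧ r = ‖π a‖}

/-- `‖a‖ = sup {‖π(a)‖ : π in the class}`. -/
def seminorm (a : A) : ℝ := sSup (R.values a)

theorem norm_le {B : BanachSp.{u}} {π : A →ₐ[ℂ] B.Op} (h : R.Mem B π) (a : A) :
    ‖π a‖ ≤ R.seminorm a := by
  obtain ⟨C, hC⟩ := R.bounded a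
  refine le_csSup ⟨C, ?_⟩ ⟨B, π, h, rfl⟩
  rintro _ ⟨B, π, hπ, rfl⟩
  exact hC B π hπ

theorem seminorm_nonneg (a : A) : 0 ≤ R.seminorm a := by
  refine Real.sSup_nonneg ?_
  rintro _ ⟨B, π, -, rfl⟩
  exact norm_nonneg _

theorem seminorm_le {a : A} {C : ℝ} (hC : 0 ≤ C)
    (h : ∀ (B : BanachSp.{u}) (π : A →ₐ[ℂ] B.Op), R.Mem B π → ‖π a‖ ≤ C) : R.seminorm a ≤ C := by
  refine Real.sSup_le ?_ hC
  rintro _ ⟨B, π, hπ, rfl⟩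
  exact h B π hπ

/-- `seminorm` as a submultiplicative seminorm on the ring `A`. -/
def ringSeminorm : RingSeminorm A where
  toFun := R.seminorm
  map_zero' := le_antisymm (R.seminorm_le le_rfl (by simp)) (R.seminorm_nonneg 0)
  add_le' a b := by
    refine R.seminorm_le (add_nonneg (R.seminorm_nonneg a) (R.seminorm_nonneg b)) ?_
    intro B π h
    rw [map_add]
    exact (norm_add_le _ _).trans (add_le_add (R.norm_le h a) (R.norm_le h b))
  neg' a := by
    unfold seminorm values
    simp only [map_neg, norm_neg]
  mul_le' a b := by
    refine R.seminorm_le (mul_nonneg (R.seminorm_nonneg a) (R.seminorm_nonneg b)) ?_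
    intro B π h
    rw [map_mul]
    exact (norm_mul_le _ _).trans
      (mul_le_mul (R.norm_le h a) (R.norm_le h b) (norm_nonneg _) (R.seminorm_nonneg a))

/-- The algebra `A`, equipped with the seminorm of the class. -/
def Pre (_R : RepClass.{u, w} A) : Type w := A

instance : SeminormedRing R.Pre := R.ringSeminorm.toSeminormedRing

instance : NormedAlgebra ℂ R.Pre where
  __ := (inferInstance : Algebra ℂ A)
  norm_smul_le z a := by
    change R.seminorm (z • (show A from a)) ≤ ‖z‖ * R.seminorm a
    refine R.seminorm_le (mul_nonneg (norm_nonneg z) (R.seminorm_nonneg a)) ?_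
    intro B π h
    rw [map_smul, norm_smul]
    exact mul_le_mul_of_nonneg_left (R.norm_le h a) (norm_nonneg z)

/-- The Banach algebra of the class: the (Hausdorff) completion of `A`. -/
abbrev Alg : Type w := UniformSpace.Completion R.Pre

/-- The continuous extension to the completion of a representation in the class. -/
def ext {B : BanachSp.{u}} (π : A →ₐ[ℂ] B.Op) : R.Alg → B.Op :=
  UniformSpace.Completion.extension (fun a : R.Pre => π a)

/-- A representation in the class is contractive, so `ext` does extend it. -/
theorem ext_coe {B : BanachSp.{u}} {π : A →ₐ[ℂ] B.Op} (h : R.Mem B π) (a : R.Pre) :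
    R.ext π (a : R.Alg) = π a := by
  refine UniformSpace.Completion.extension_coe ?_ a
  refine (LipschitzWith.of_dist_le_mul (K := 1) ?_).uniformContinuous
  intro x y
  rw [NNReal.coe_one, one_mul, dist_eq_norm, dist_eq_norm]
  have h' := R.norm_le h ((show A from x) - (show A from y))
  rw [map_sub] at h'
  exact h'

/-- The involution of `A`. -/
def starPre [Star A] (a : R.Pre) : R.Pre := @star A _ a

/-- The extension of the involution of `A` to the completion by continuity. -/
def starExt [Star A] : R.Alg → R.Alg := UniformSpace.Completion.map R.starPre

/-- A Kazhdan projection: a selfadjoint idempotent of the Banach algebra of the class that every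
representation of the class sends to a projection onto its subspace of invariant vectors. -/
structure IsKazhdanProjection [Star A]
    (invariants : (B : BanachSp.{u}) → (A →ₐ[ℂ] B.Op) → Submodule ℂ B.carrier)
    (p : R.Alg) : Prop where
  idempotent : IsIdempotentElem p
  selfadjoint : R.starExt p = p
  isProj : ∀ (B : BanachSp.{u}) (π : A →ₐ[ℂ] B.Op), R.Mem B π →
    LinearMap.IsProj (invariants B π) (R.ext π p)

end RepClass

/-! ## Strong Banach property (T) for groups -/

/-- A length function on a group. -/
structure LengthFunction (Γ : Type v) [Group Γ] where
  toFun : Γ → ℝ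
  nonneg : ∀ g, 0 ≤ toFun g
  map_one : toFun 1 = 0
  map_inv : ∀ g, toFun g⁻¹ = toFun g
  map_mul_le : ∀ g h, toFun (g * h) ≤ toFun g + toFun h

instance (Γ : Type v) [Group Γ] : CoeFun (LengthFunction Γ) (fun _ => Γ → ℝ) :=
  ⟨LengthFunction.toFun⟩

section Groups

variable {Γ : Type v} [Group Γ]

/-- The involution `f*(g) = conj (f(g⁻¹))` of the complex group algebra. -/
instance : Star (MonoidAlgebra ℂ Γ) where
  star f := MonoidAlgebra.ofCoeff
    ((f.coeff.mapRange (starRingEnd ℂ) (map_zero _)).equivMapDomain (Equiv.inv Γ))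

theorem star_coeff (f : MonoidAlgebra ℂ Γ) (g : Γ) :
    (star f).coeff g = starRingEnd ℂ (f.coeff g⁻¹) := rfl

/-- The representations of `ℂΓ` (equivalently, of `Γ`) on members of `𝔅` with
`(ℓ, s, c)`-small exponential growth. -/
def groupReps (𝔅 : Set BanachSp.{u}) (ℓ : LengthFunction Γ) (s c : ℝ) :
    RepClass.{u, v} (MonoidAlgebra ℂ Γ) where
  Mem B π := B ∈ 𝔅 ∧ ∀ g : Γ, ‖π (MonoidAlgebra.of ℂ Γ g)‖ ≤ c * Real.exp (s * ℓ g)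
  bounded a := by
    induction a using MonoidAlgebra.induction_on with
    | of g => exact ⟨_, fun B π h => h.2 g⟩
    | add a b ha hb =>
      obtain ⟨C, hC⟩ := ha
      obtain ⟨D, hD⟩ := hb
      refine ⟨C + D, fun B π h => ?_⟩
      rw [map_add]
      exact (norm_add_le _ _).trans (add_le_add (hC B π h) (hD B π h))
    | smul z a ha =>
      obtain ⟨C, hC⟩ := ha
      refine ⟨‖z‖ * C, fun B π h => ?_⟩
      rw [map_smul, norm_smul]
      exact mul_le_mul_of_nonneg_left (hC B π h) (norm_nonneg z)

/-- The vectors fixed by `Γ`. -/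
def groupInvariants (B : BanachSp.{u}) (π : MonoidAlgebra ℂ Γ →ₐ[ℂ] B.Op) :
    Submodule ℂ B.carrier where
  carrier := {ξ | ∀ g : Γ, π (MonoidAlgebra.of ℂ Γ g) ξ = ξ}
  add_mem' ha hb g := by rw [map_add, ha g, hb g]
  zero_mem' g := map_zero _
  smul_mem' z a ha g := by rw [map_smul, ha g]

/-- Strong Banach property (T) of a (discrete) group with respect to the family `𝔅`. -/
def StrongBanachT (𝔅 : Set BanachSp.{u}) (Γ : Type v) [Group Γ] : Prop :=
  ∀ ℓ : LengthFunction Γ, ∃ s : ℝ, 0 < s ∧ ∀ c : ℝ, 0 < c →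
    ∃ p : (groupReps 𝔅 ℓ s c).Alg, (groupReps 𝔅 ℓ s c).IsKazhdanProjection groupInvariants p

end Groups

/-! ## The algebraic uniform Roe algebra -/

/-- Bounded geometry of an extended metric space: balls of a given radius have uniformly bounded
cardinality. -/
class BoundedGeometry (X : Type v) [EMetricSpace X] : Prop where
  exists_bound : ∀ R : ℝ≥0, ∃ N : ℕ, ∀ x : X, {y : X | edist x y ≤ R}.encard ≤ N

section Roe

variable {X : Type v}

/-- The matrix entry `T_{xy}` of an operator on finitely supported functions. -/
def entry (T : Module.End ℂ (X →₀ ℂ)) (x y : X) : ℂ := T (Finsupp.single y 1) x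

theorem entry_ext {S T : Module.End ℂ (X →₀ ℂ)} (h : ∀ x y, entry S x y = entry T x y) :
    S = T := by
  refine Finsupp.lhom_ext' fun y => LinearMap.ext_ring (Finsupp.ext fun x => ?_)
  exact h x y

theorem entry_mul (S T : Module.End ℂ (X →₀ ℂ)) (x z : X) :
    entry (S * T) x z = ∑ y ∈ (T (Finsupp.single z 1)).support, entry T y z * entry S x y := by
  have h : T (Finsupp.single z 1) =
      ∑ y ∈ (T (Finsupp.single z 1)).support, entry T y z • Finsupp.single y (1 : ℂ) := by
    conv_lhs => rw [← Finsupp.sum_single (T (Finsupp.single z 1))]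
    simp [Finsupp.sum, entry]
  unfold entry at h ⊢
  rw [Module.End.mul_apply]
  conv_lhs => rw [h]
  rw [map_sum, Finsupp.finsetSum_apply]
  refine Finset.sum_congr rfl fun y _ => ?_
  rw [map_smul, Finsupp.smul_apply, smul_eq_mul]

variable [EMetricSpace X]

/-- A complex `X`-by-`X` matrix with bounded entries and finite propagation. -/
structure IsRoeMatrix (m : X → X → ℂ) : Prop where
  bounded : ∃ M : ℝ, ∀ x y, ‖m x y‖ ≤ M
  propagation : ∃ R : ℝ≥0, ∀ x y, m x y ≠ 0 → edist x y ≤ R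

theorem ball_finite [BoundedGeometry X] (R : ℝ≥0) (x : X) : {y : X | edist x y ≤ R}.Finite := by
  obtain ⟨N, hN⟩ := BoundedGeometry.exists_bound (X := X) R
  exact Set.finite_of_encard_le_coe (hN x)

theorem IsRoeMatrix.column_finite [BoundedGeometry X] {m : X → X → ℂ} (hm : IsRoeMatrix m)
    (y : X) : (Function.support fun x => m x y).Finite := by
  obtain ⟨R, hR⟩ := hm.propagation
  refine (ball_finite R y).subset fun x hx => ?_
  rw [Set.mem_ofPred_eq, edist_comm]
  exact hR x y hx

variable (X) in
/-- The algebraic uniform Roe algebra `ℂ_u[X]` of matrices with bounded entries and finite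
propagation; a matrix is regarded as an operator on the finitely supported functions on `X`. -/
def UniformRoe [BoundedGeometry X] : Subalgebra ℂ (Module.End ℂ (X →₀ ℂ)) where
  carrier := {T | IsRoeMatrix (entry T)}
  algebraMap_mem' z := by
    classical
    have h : ∀ x y : X, entry (algebraMap ℂ (Module.End ℂ (X →₀ ℂ)) z) x y =
        if y = x then z else 0 := by
      intro x y
      simp [entry, Finsupp.single_apply]
    refine ⟨⟨‖z‖, fun x y => ?_⟩, ⟨0, fun x y hxy => ?_⟩⟩
    · rw [h]; split_ifs <;> simp
    · rw [h] at hxy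
      have : y = x := by by_contra hne; exact hxy (if_neg hne)
      simp [this]
  add_mem' {S T} hS hT := by
    have h : ∀ x y : X, entry (S + T) x y = entry S x y + entry T x y := fun x y => rfl
    obtain ⟨⟨M, hM⟩, ⟨R, hR⟩⟩ := hS
    obtain ⟨⟨M', hM'⟩, ⟨R', hR'⟩⟩ := hT
    refine ⟨⟨M + M', fun x y => ?_⟩, ⟨max R R', fun x y hxy => ?_⟩⟩
    · rw [h]; exact (norm_add_le _ _).trans (add_le_add (hM x y) (hM' x y))
    · rw [h] at hxy
      by_cases h0 : entry S x y = 0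
      · rw [h0, zero_add] at hxy
        exact (hR' x y hxy).trans (by exact_mod_cast le_max_right R R')
      · exact (hR x y h0).trans (by exact_mod_cast le_max_left R R')
  mul_mem' {S T} hS hT := by
    obtain ⟨⟨M, hM⟩, ⟨R, hR⟩⟩ := hS
    obtain ⟨⟨M', hM'⟩, ⟨R', hR'⟩⟩ := hT
    refine ⟨?_, ⟨R + R', fun x z hxz => ?_⟩⟩
    · obtain ⟨N, hN⟩ := BoundedGeometry.exists_bound (X := X) R'
      refine ⟨N * (|M'| * |M|), fun x z => ?_⟩
      rw [entry_mul]
      have hcard : (T (Finsupp.single z 1)).support.card ≤ N := by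
        have h1 : ((T (Finsupp.single z 1)).support : Set X) ⊆ {y : X | edist z y ≤ R'} := by
          intro y hy
          rw [Set.mem_ofPred_eq, edist_comm]
          exact hR' y z (Finsupp.mem_support_iff.1 hy)
        have h2 := (Set.encard_le_encard h1).trans (hN z)
        rw [Set.encard_coe_eq_coe_finsetCard] at h2
        exact_mod_cast h2
      refine (norm_sum_le_of_le _ (fun y _ => ?_ : ∀ y ∈ _, _ ≤ |M'| * |M|)).trans ?_
      · rw [norm_mul]
        exact mul_le_mul ((hM' y z).trans (le_abs_self _)) ((hM x y).trans (le_abs_self _))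
          (norm_nonneg _) (abs_nonneg _)
      · rw [Finset.sum_const, nsmul_eq_mul]
        refine mul_le_mul_of_nonneg_right ?_ (by positivity)
        exact_mod_cast hcard
    · rw [entry_mul] at hxz
      obtain ⟨y, -, hy⟩ := Finset.exists_ne_zero_of_sum_ne_zero hxz
      have h1 := hR x y (right_ne_zero_of_mul hy)
      have h2 := hR' y z (left_ne_zero_of_mul hy)
      push_cast
      exact (edist_triangle x y z).trans (add_le_add h1 h2)

variable [BoundedGeometry X]

instance : Ring (UniformRoe X) := Algebra.semiringToRing ℂ

/-- The element of `ℂ_u[X]` with a given matrix. -/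
def ofMatrix (m : X → X → ℂ) (hm : IsRoeMatrix m) : UniformRoe X :=
  ⟨Finsupp.lift (X →₀ ℂ) ℂ X
      fun y => Finsupp.ofSupportFinite (fun x => m x y) (hm.column_finite y), by
    have h : entry (Finsupp.lift (X →₀ ℂ) ℂ X
        fun y => Finsupp.ofSupportFinite (fun x => m x y) (hm.column_finite y)) = m := by
      funext x y
      simp [entry, Finsupp.ofSupportFinite_coe]
    change IsRoeMatrix _
    rwa [h]⟩

@[simp]
theorem entry_ofMatrix (m : X → X → ℂ) (hm : IsRoeMatrix m) (x y : X) :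
    entry (ofMatrix m hm).1 x y = m x y := by
  simp [ofMatrix, entry, Finsupp.ofSupportFinite_coe]

theorem isRoeMatrix_entry (T : UniformRoe X) : IsRoeMatrix (entry T.1) := T.2

/-- The conjugate transpose `T*_{xy} = conj T_{yx}`. -/
instance : Star (UniformRoe X) where
  star T := ofMatrix (fun x y => starRingEnd ℂ (entry T.1 y x)) (by
    obtain ⟨⟨M, hM⟩, ⟨R, hR⟩⟩ := isRoeMatrix_entry T
    refine ⟨⟨M, fun x y => by simpa using hM y x⟩, ⟨R, fun x y h => ?_⟩⟩
    rw [edist_comm]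
    exact hR y x fun h0 => h (by rw [h0, map_zero]))

open Classical in
/-- The diagonal operator of a bounded function `f` on `X`. -/
def diagonal (f : X → ℂ) (hf : ∃ M : ℝ, ∀ x, ‖f x‖ ≤ M) : UniformRoe X :=
  ofMatrix (fun x y => if x = y then f x else 0) (by
    obtain ⟨M, hM⟩ := hf
    refine ⟨⟨M, fun x y => ?_⟩, ⟨0, fun x y h => ?_⟩⟩
    · split_ifs
      · exact hM x
      · simpa using (norm_nonneg _).trans (hM x)
    · have hxy : x = y := by by_contra hne; exact h (if_neg hne)
      simp [hxy])

/-- The diagonal projection given by the characteristic function of a subset of `X`. -/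
def chi (D : Set X) : UniformRoe X :=
  diagonal (D.indicator fun _ => 1) ⟨1, fun x => by
    by_cases h : x ∈ D <;> simp [h]⟩

/-- A partial translation: a `0`-`1` matrix in `ℂ_u[X]` with at most one nonzero entry in each row
and each column. -/
structure IsPartialTranslation (V : UniformRoe X) : Prop where
  zero_or_one : ∀ x y, entry V.1 x y = 0 ∨ entry V.1 x y = 1
  row : ∀ x y y', entry V.1 x y ≠ 0 → entry V.1 x y' ≠ 0 → y = y'
  column : ∀ x x' y, entry V.1 x y ≠ 0 → entry V.1 x' y ≠ 0 → x = x'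

/-- The range `R_V` of the local bijection of a partial translation `V`. -/
def rangeOf (V : UniformRoe X) : Set X := {x | ∃ y, entry V.1 x y ≠ 0}

/-- The vectors `ξ` with `π(V) ξ = π(χ_{R_V}) ξ` for every partial translation `V`. -/
def roeInvariants (B : BanachSp.{u}) (π : UniformRoe X →ₐ[ℂ] B.Op) :
    Submodule ℂ B.carrier where
  carrier := {ξ | ∀ V : UniformRoe X, IsPartialTranslation V → π V ξ = π (chi (rangeOf V)) ξ}
  add_mem' ha hb V hV := by rw [map_add, map_add, ha V hV, hb V hV]
  zero_mem' V _ := by rw [map_zero, map_zero]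
  smul_mem' z a ha V hV := by rw [map_smul, map_smul, ha V hV]

/-! ## Finer metrics and small exponential growth -/

variable (X) in
/-- A second extended metric `δ` on `X` that is finer than the given one: the identity map from
`X` to `(X, δ)` is bornologous. (Points at `δ`-distance `0` are allowed.) -/
structure FinerMetric where
  metric : PseudoEMetricSpace X
  bornologous : ∀ R : ℝ≥0, ∃ R' : ℝ≥0, ∀ x y : X, edist x y ≤ R → metric.edist x y ≤ R'

/-- The `δ`-propagation of `T`, the supremum of `δ(x, y)` over the support of `T`. -/
def FinerMetric.prop (δ : FinerMetric X) (T : UniformRoe X) : ℝ≥0∞ :=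
  ⨆ (x : X) (y : X) (_ : entry T.1 x y ≠ 0), δ.metric.edist x y

/-- The `δ`-propagation is finite, since `δ` is finer than the metric of `X`. -/
theorem FinerMetric.prop_lt_top (δ : FinerMetric X) (T : UniformRoe X) : δ.prop T < ⊤ := by
  obtain ⟨R, hR⟩ := (isRoeMatrix_entry T).propagation
  obtain ⟨R', hR'⟩ := δ.bornologous R
  refine lt_of_le_of_lt ?_ (ENNReal.coe_lt_top (r := R'))
  exact iSup_le fun x => iSup_le fun y => iSup_le fun h => hR' x y (hR x y h)

/-- A unital representation `π` of `ℂ_u[X]` has `(δ, s, c)`-small exponential growth. -/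
def SmallGrowth (δ : FinerMetric X) (s c : ℝ) {B : BanachSp.{u}}
    (π : UniformRoe X →ₐ[ℂ] B.Op) : Prop :=
  ∀ V : UniformRoe X, IsPartialTranslation V → ‖π V‖ ≤ c * Real.exp (s * (δ.prop V).toReal)

/-- The restriction of `π` to the diagonal subalgebra `ℓ^∞(X)` is a bounded operator for the
supremum norm. -/
def BoundedOnDiagonal {B : BanachSp.{u}} (π : UniformRoe X →ₐ[ℂ] B.Op) : Prop :=
  ∃ K : ℝ, ∀ (f : X → ℂ) (M : ℝ) (hf : ∀ x, ‖f x‖ ≤ M), ‖π (diagonal f ⟨M, hf⟩)‖ ≤ K * M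

theorem entry_diagonal (f : X → ℂ) (hf : ∃ M : ℝ, ∀ x, ‖f x‖ ≤ M) (x y : X) [Decidable (x = y)] :
    entry (diagonal f hf).1 x y = if x = y then f x else 0 := by
  refine (entry_ofMatrix _ _ x y).trans ?_
  congr

theorem entry_diagonal_mul (f : X → ℂ) (hf : ∃ M : ℝ, ∀ x, ‖f x‖ ≤ M) (T : UniformRoe X)
    (x y : X) : entry (diagonal f hf * T).1 x y = f x * entry T.1 x y := by
  classical
  have h : ∀ v : X →₀ ℂ, (diagonal f hf).1 v x = f x * v x := by
    intro v
    induction v using Finsupp.induction_linear with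
    | zero => simp
    | add a b ha hb => rw [map_add, Finsupp.add_apply, ha, hb, Finsupp.add_apply, mul_add]
    | single z a =>
      have h1 : (Finsupp.single z a : X →₀ ℂ) = a • Finsupp.single z 1 := by simp
      have h3 : (diagonal f hf).1 (Finsupp.single z 1) x = if x = z then f x else 0 :=
        entry_diagonal f hf x z
      rw [h1, map_smul, Finsupp.smul_apply, h3]
      by_cases hxz : x = z
      · simp [hxz, mul_comm]
      · simp [hxz]
  exact h _

theorem isPartialTranslation_chi (D : Set X) : IsPartialTranslation (chi D) := by
  classical
  have h : ∀ x y, entry (chi D).1 x y ≠ 0 → x = y := by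
    intro x y hxy
    by_contra hne
    exact hxy (by rw [chi, entry_diagonal, if_neg hne])
  refine ⟨fun x y => ?_, fun x y y' h1 h2 => (h x y h1).symm.trans (h x y' h2),
    fun x x' y h1 h2 => (h x y h1).trans (h x' y h2).symm⟩
  rw [chi, entry_diagonal]
  by_cases hxy : x = y
  · by_cases hD : x ∈ D
    · right; simp [← hxy, hD]
    · left; simp [← hxy, hD]
  · left; simp [hxy]

theorem diagonal_comb {f g h : X → ℂ} (a b : ℂ) (hfgh : ∀ x, f x = a * g x + b * h x)
    (hf : ∃ M : ℝ, ∀ x, ‖f x‖ ≤ M) (hg : ∃ M : ℝ, ∀ x, ‖g x‖ ≤ M)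
    (hh : ∃ M : ℝ, ∀ x, ‖h x‖ ≤ M) :
    diagonal f hf = a • diagonal g hg + b • diagonal h hh := by
  classical
  refine Subtype.ext (entry_ext fun x y => ?_)
  have e : entry (a • diagonal g hg + b • diagonal h hh).1 x y =
      a * entry (diagonal g hg).1 x y + b * entry (diagonal h hh).1 x y := rfl
  rw [e, entry_diagonal, entry_diagonal, entry_diagonal]
  split_ifs
  · exact hfgh x
  · simp

/-- A representation that is bounded on the diagonal is bounded there by a constant that depends
only on its values on the diagonal projections. -/
theorem norm_diagonal_le {B : BanachSp.{u}} {π : UniformRoe X →ₐ[ℂ] B.Op}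
    (hπ : BoundedOnDiagonal π) {C : ℝ} (hC : ∀ D : Set X, ‖π (chi D)‖ ≤ C)
    (f : X → ℂ) (M : ℝ) (hM : 0 < M) (hf : ∀ x, ‖f x‖ ≤ M) :
    ‖π (diagonal f ⟨M, hf⟩)‖ ≤ 4 * C * M := by
  classical
  obtain ⟨K, hK⟩ := hπ
  have hC0 : 0 ≤ C := (norm_nonneg _).trans (hC ∅)
  have hb : ∀ g : X → ℝ, (∀ x, 0 ≤ g x ∧ g x ≤ 1) → ∀ x, ‖(g x : ℂ)‖ ≤ 1 := by
    intro g hg x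
    rw [Complex.norm_real, Real.norm_eq_abs, abs_of_nonneg (hg x).1]
    exact (hg x).2
  have hind : ∀ D : Set X, ∀ x, ‖(D.indicator (fun _ => (1 : ℂ)) x)‖ ≤ 1 := by
    intro D x
    by_cases h : x ∈ D <;> simp [h]
  have key : ∀ n : ℕ, ∀ (g : X → ℝ) (hg : ∀ x, 0 ≤ g x ∧ g x ≤ 1),
      ‖π (diagonal (fun x => (g x : ℂ)) ⟨1, hb g hg⟩)‖ ≤ C + K * (1 / 2) ^ n := by
    intro n
    induction n with
    | zero =>
      intro g hg
      have := hK (fun x => (g x : ℂ)) 1 (hb g hg)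
      simp only [mul_one] at this
      simp only [pow_zero, mul_one]
      linarith
    | succ n ih =>
      intro g hg
      let D : Set X := {x | 1 / 2 ≤ g x}
      let g' : X → ℝ := fun x => if 1 / 2 ≤ g x then 2 * g x - 1 else 2 * g x
      have hg' : ∀ x, 0 ≤ g' x ∧ g' x ≤ 1 := by
        intro x
        have := hg x
        by_cases h : 1 / 2 ≤ g x
        · simp only [g', if_pos h]; constructor <;> linarith
        · simp only [g', if_neg h]; constructor <;> linarith
      have hcomb := diagonal_comb (f := fun x => (g x : ℂ)) (g := D.indicator fun _ => 1)
        (h := fun x => (g' x : ℂ)) (1 / 2) (1 / 2) (by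
          intro x
          by_cases h : 1 / 2 ≤ g x
          · have hx : x ∈ D := h
            simp only [g', if_pos h, Set.indicator_of_mem hx]
            push_cast
            ring
          · have hx : x ∉ D := h
            simp only [g', if_neg h, Set.indicator_of_notMem hx]
            push_cast
            ring) ⟨1, hb g hg⟩ ⟨1, hind D⟩ ⟨1, hb g' hg'⟩
      rw [hcomb, map_add, map_smul, map_smul]
      refine (norm_add_le _ _).trans ?_
      rw [norm_smul, norm_smul]
      have h1 : ‖π (diagonal (D.indicator fun _ => 1) ⟨1, hind D⟩)‖ ≤ C := hC D
      have h2 := ih g' hg'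
      have h3 : ‖(1 / 2 : ℂ)‖ = 1 / 2 := by simp
      rw [h3, pow_succ]
      linarith
  have key' : ∀ (g : X → ℝ) (hg : ∀ x, 0 ≤ g x ∧ g x ≤ 1),
      ‖π (diagonal (fun x => (g x : ℂ)) ⟨1, hb g hg⟩)‖ ≤ C := by
    intro g hg
    have ht : Filter.Tendsto (fun n : ℕ => C + K * (1 / 2 : ℝ) ^ n) Filter.atTop
        (nhds (C + K * 0)) :=
      ((tendsto_pow_atTop_nhds_zero_of_lt_one (by norm_num) (by norm_num)).const_mul K).const_add C
    rw [mul_zero, add_zero] at ht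
    exact ge_of_tendsto' ht fun n => key n g hg
  have real : ∀ (g : X → ℝ) (hg : ∀ x, |g x| ≤ 1) (h : ∀ x, ‖(g x : ℂ)‖ ≤ 1),
      ‖π (diagonal (fun x => (g x : ℂ)) ⟨1, h⟩)‖ ≤ 2 * C := by
    intro g hg h
    have hp : ∀ x, 0 ≤ max (g x) 0 ∧ max (g x) 0 ≤ 1 := fun x =>
      ⟨le_max_right _ _, max_le (le_of_abs_le (hg x)) zero_le_one⟩
    have hn : ∀ x, 0 ≤ max (-g x) 0 ∧ max (-g x) 0 ≤ 1 := fun x =>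
      ⟨le_max_right _ _, max_le (by linarith [neg_le_of_abs_le (hg x)]) zero_le_one⟩
    rw [diagonal_comb (f := fun x => (g x : ℂ)) (g := fun x => ((max (g x) 0 : ℝ) : ℂ))
      (h := fun x => ((max (-g x) 0 : ℝ) : ℂ)) 1 (-1) (by
        intro x
        have : g x = 1 * max (g x) 0 + (-1) * max (-g x) 0 := by
          rcases le_total 0 (g x) with h0 | h0
          · rw [max_eq_left h0, max_eq_right (by linarith)]; ring
          · rw [max_eq_right h0, max_eq_left (by linarith)]; ring
        exact_mod_cast this) ⟨1, h⟩ ⟨1, hb _ hp⟩ ⟨1, hb _ hn⟩]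
    rw [map_add, map_smul, map_smul]
    refine (norm_add_le _ _).trans ?_
    rw [norm_smul, norm_smul, norm_neg, norm_one]
    linarith [key' _ hp, key' _ hn]
  have hre : ∀ x, |(f x).re / M| ≤ 1 := fun x => by
    rw [abs_div, abs_of_pos hM, div_le_one hM]
    exact (Complex.abs_re_le_norm _).trans (hf x)
  have him : ∀ x, |(f x).im / M| ≤ 1 := fun x => by
    rw [abs_div, abs_of_pos hM, div_le_one hM]
    exact (Complex.abs_im_le_norm _).trans (hf x)
  have hre' : ∀ x, ‖(((f x).re / M : ℝ) : ℂ)‖ ≤ 1 := fun x => by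
    rw [Complex.norm_real]; exact hre x
  have him' : ∀ x, ‖(((f x).im / M : ℝ) : ℂ)‖ ≤ 1 := fun x => by
    rw [Complex.norm_real]; exact him x
  rw [diagonal_comb (f := f) (g := fun x => (((f x).re / M : ℝ) : ℂ))
    (h := fun x => (((f x).im / M : ℝ) : ℂ)) (M : ℂ) (M * Complex.I) (by
      intro x
      have hM' : (M : ℂ) ≠ 0 := by exact_mod_cast hM.ne'
      push_cast
      rw [mul_div_cancel₀ _ hM', mul_assoc, mul_div_assoc', mul_div_assoc', 
        mul_div_cancel_left₀ _ hM', mul_comm Complex.I]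
      exact (Complex.re_add_im (f x)).symm) ⟨M, hf⟩ ⟨1, hre'⟩ ⟨1, him'⟩]
  rw [map_add, map_smul, map_smul]
  refine (norm_add_le _ _).trans ?_
  rw [norm_smul, norm_smul, norm_mul, Complex.norm_I, mul_one, Complex.norm_real,
    Real.norm_eq_abs, abs_of_pos hM]
  have h1 := mul_le_mul_of_nonneg_left (real _ hre hre') hM.le
  have h2 := mul_le_mul_of_nonneg_left (real _ him him') hM.le
  linarith

/-- Every element of `ℂ_u[X]` is a finite sum of products `f V` with `f ∈ ℓ^∞(X)` and `V` a partial
translation. -/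
theorem exists_decomposition (T : UniformRoe X) :
    ∃ (n : ℕ) (f : Fin n → X → ℂ) (M : ℝ) (_ : 0 < M) (hf : ∀ i x, ‖f i x‖ ≤ M)
      (V : Fin n → UniformRoe X), (∀ i, IsPartialTranslation (V i)) ∧
      T = ∑ i, diagonal (f i) ⟨M, hf i⟩ * V i := by
  classical
  obtain ⟨⟨M, hM⟩, ⟨R, hR⟩⟩ := isRoeMatrix_entry T
  obtain ⟨N, hN⟩ := BoundedGeometry.exists_bound (X := X) R
  have hr : ∀ x : X, ∃ r : X → ℕ, {y : X | edist x y ≤ R} ⊆ r ⁻¹' (Finset.range N : Set ℕ) ∧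
      Set.InjOn r {y : X | edist x y ≤ R} := fun x =>
    (ball_finite R x).exists_injOn_of_encard_le (by
      rw [Set.encard_coe_eq_coe_finsetCard, Finset.card_range]
      exact hN x)
  choose r hrN hrI using hr
  have hlt : ∀ {x y : X}, edist x y ≤ R → r x y < N := fun {x y} h =>
    Finset.mem_range.1 (Finset.mem_coe.1 (hrN x h))
  let P : Fin N × Fin N → X → X → Prop := fun p x y =>
    edist x y ≤ R ∧ r x y = p.1 ∧ r y x = p.2
  have hP : ∀ {p x y y'}, P p x y → P p x y' → y = y' := fun {p x y y'} h h' =>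
    hrI x h.1 h'.1 (h.2.1.trans h'.2.1.symm)
  have hP' : ∀ {p x x' y}, P p x y → P p x' y → x = x' := fun {p x x' y} h h' =>
    hrI y (by rw [Set.mem_ofPred_eq, edist_comm]; exact h.1)
      (by rw [Set.mem_ofPred_eq, edist_comm]; exact h'.1) (h.2.2.trans h'.2.2.symm)
  have hV : ∀ p, IsRoeMatrix fun x y => if P p x y then (1 : ℂ) else 0 := by
    intro p
    refine ⟨⟨1, fun x y => ?_⟩, ⟨R, fun x y h => ?_⟩⟩
    · split_ifs <;> simp
    · by_contra hne
      exact h (if_neg fun h' => hne h'.1)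
  let F : Fin N × Fin N → X → ℂ := fun p x =>
    if h : ∃ y, P p x y then entry T.1 x h.choose else 0
  have hF : ∀ p x, ‖F p x‖ ≤ |M| + 1 := by
    intro p x
    by_cases h : ∃ y, P p x y
    · simp only [F, dif_pos h]
      linarith [hM x h.choose, le_abs_self M]
    · simp only [F, dif_neg h, norm_zero]
      positivity
  let e := Fintype.equivFin (Fin N × Fin N)
  refine ⟨Fintype.card (Fin N × Fin N), fun i => F (e.symm i), |M| + 1, by positivity,
    fun i => hF (e.symm i), fun i => ofMatrix _ (hV (e.symm i)), fun i => ?_, ?_⟩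
  · refine ⟨fun x y => ?_, fun x y y' h h' => ?_, fun x x' y h h' => ?_⟩
    · rw [entry_ofMatrix]; split_ifs <;> simp
    · rw [entry_ofMatrix] at h h'
      exact hP (not_not.1 fun hn => h (if_neg hn)) (not_not.1 fun hn => h' (if_neg hn))
    · rw [entry_ofMatrix] at h h'
      exact hP' (not_not.1 fun hn => h (if_neg hn)) (not_not.1 fun hn => h' (if_neg hn))
  · rw [e.symm.sum_comp fun p => diagonal (F p) ⟨|M| + 1, hF p⟩ * ofMatrix _ (hV p)]
    refine Subtype.ext (entry_ext fun x y => ?_)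
    have hsum : ∀ (s : Finset (Fin N × Fin N)) (W : Fin N × Fin N → UniformRoe X),
        entry (∑ p ∈ s, W p).1 x y = ∑ p ∈ s, entry (W p).1 x y := by
      intro s W
      induction s using Finset.induction_on with
      | empty => rfl
      | insert a s ha ih =>
        rw [Finset.sum_insert ha, Finset.sum_insert ha, ← ih]
        rfl
    rw [hsum]
    simp only [entry_diagonal_mul, entry_ofMatrix]
    by_cases hxy : edist x y ≤ R
    · have hyx : edist y x ≤ R := by rwa [edist_comm]
      have hp : P (⟨r x y, hlt hxy⟩, ⟨r y x, hlt hyx⟩) x y := ⟨hxy, rfl, rfl⟩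
      rw [Finset.sum_eq_single (⟨r x y, hlt hxy⟩, ⟨r y x, hlt hyx⟩)]
      · have hex : ∃ y', P (⟨r x y, hlt hxy⟩, ⟨r y x, hlt hyx⟩) x y' := ⟨y, hp⟩
        rw [if_pos hp, mul_one]
        simp only [F, dif_pos hex]
        rw [hP hex.choose_spec hp]
      · intro p _ hne
        rw [if_neg, mul_zero]
        intro h
        exact hne (Prod.ext (Fin.ext h.2.1.symm) (Fin.ext h.2.2.symm))
      · intro h
        exact absurd (Finset.mem_univ _) h
    · have h0 : entry T.1 x y = 0 := not_not.1 fun h => hxy (hR x y h)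
      rw [h0]
      refine (Finset.sum_eq_zero fun p _ => ?_).symm
      rw [if_neg fun h => hxy h.1, mul_zero]

/-- The representations of `ℂ_u[X]` on members of `𝔅` with `(δ, s, c)`-small exponential growth. -/
def roeReps (𝔅 : Set BanachSp.{u}) (δ : FinerMetric X) (s c : ℝ) :
    RepClass.{u, v} (UniformRoe X) where
  Mem B π := B ∈ 𝔅 ∧ BoundedOnDiagonal π ∧ SmallGrowth δ s c π
  bounded T := by
    obtain ⟨n, f, M, hM, hf, V, hV, hT⟩ := exists_decomposition T
    have hprop : ∀ D : Set X, δ.prop (chi D) = 0 := by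
      classical
      intro D
      refine le_antisymm (iSup_le fun x => iSup_le fun y => iSup_le fun h => ?_) bot_le
      have hxy : x = y := by
        by_contra hne
        exact h (by rw [chi, entry_diagonal, if_neg hne])
      rw [hxy, δ.metric.edist_self]
    refine ⟨∑ i, 4 * c * M * (c * Real.exp (s * (δ.prop (V i)).toReal)), fun B π h => ?_⟩
    have hchi : ∀ D : Set X, ‖π (chi D)‖ ≤ c := by
      intro D
      have := h.2.2 _ (isPartialTranslation_chi D)
      simpa [hprop D] using this
    have hc : 0 ≤ c := (norm_nonneg _).trans (hchi ∅)
    have hsum : π T = ∑ i, π (diagonal (f i) ⟨M, hf i⟩) * π (V i) := by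
      conv_lhs => rw [hT]
      rw [map_sum]
      exact Finset.sum_congr rfl fun i _ => map_mul π _ _
    rw [hsum]
    refine norm_sum_le_of_le _ fun i _ => (norm_mul_le _ _).trans ?_
    exact mul_le_mul (norm_diagonal_le h.2.1 hchi (f i) M hM (hf i)) (h.2.2 _ (hV i))
      (norm_nonneg _) (by positivity)

/-- Geometric strong Banach property (T) of `X` with respect to the family `𝔅` and a set `D` of
metrics that are finer than the metric of `X`. -/
def GeometricStrongBanachT (𝔅 : Set BanachSp.{u}) (D : Set (FinerMetric X)) : Prop :=
  ∀ δ ∈ D, ∃ s : ℝ, 0 < s ∧ ∀ c : ℝ, 0 < c →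
    ∃ p : (roeReps 𝔅 δ s c).Alg, (roeReps 𝔅 δ s c).IsKazhdanProjection roeInvariants p

end Roe

/-! ## Box spaces -/

/-- The data of a box space of `Γ`: a filtration, that is a decreasing sequence of finite index
normal subgroups with trivial intersection, and a proper length function that vanishes only at the
identity. -/
structure BoxSpace (Γ : Type v) [Group Γ] where
  N : ℕ → Subgroup Γ
  normal : ∀ n, (N n).Normal
  finiteIndex : ∀ n, (N n).FiniteIndex
  antitone : Antitone N
  iInf_eq_bot : ⨅ n, N n = ⊥
  length : LengthFunction Γ
  proper : ∀ R : ℝ, {g : Γ | length g ≤ R}.Finite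
  eq_one_of_length_eq_zero : ∀ g, length g = 0 → g = 1

namespace BoxSpace

variable {Γ : Type v} [Group Γ]

/-- The underlying set, the disjoint union of the quotients `Γ / Nₙ`. -/
def Carrier (b : BoxSpace Γ) : Type v := Σ n, Γ ⧸ b.N n

/-- The class of `g` in the `n`-th quotient. -/
def pt (b : BoxSpace Γ) (n : ℕ) (g : Γ) : b.Carrier := ⟨n, (g : Γ ⧸ b.N n)⟩

/-- `Γ` acts by left translations on each `Γ / Nₙ`. -/
instance (b : BoxSpace Γ) : MulAction Γ b.Carrier :=
  inferInstanceAs (MulAction Γ (Σ n, Γ ⧸ b.N n))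

variable (b : BoxSpace Γ)

theorem smul_pt (γ : Γ) (n : ℕ) (g : Γ) : γ • b.pt n g = b.pt n (γ * g) := rfl

theorem pt_eq_pt {n : ℕ} {g h : Γ} : b.pt n g = b.pt n h ↔ g⁻¹ * h ∈ b.N n := by
  rw [← QuotientGroup.eq]
  change (⟨n, (g : Γ ⧸ b.N n)⟩ : Σ n, Γ ⧸ b.N n) = ⟨n, (h : Γ ⧸ b.N n)⟩ ↔ _
  simp

theorem exists_pt (x : b.Carrier) : ∃ n g, x = b.pt n g := by
  obtain ⟨n, x⟩ := x
  obtain ⟨g, rfl⟩ := QuotientGroup.mk_surjective x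
  exact ⟨n, g, rfl⟩

/-- The quotient distance on the box space of the right invariant distance `(g, h) ↦ ℓ(g h⁻¹)` on
`Γ`, written as the infimum of `ℓ(γ)` over all `γ` with `γ y = x`; it is `∞` if `x` and `y` lie in
different quotients. -/
def quotientDist (ℓ : LengthFunction Γ) (x y : b.Carrier) : ℝ≥0∞ :=
  ⨅ (γ : Γ) (_ : γ • y = x), ENNReal.ofReal (ℓ γ)

/-- On `Γ / Nₙ` this is the infimum of the distance over all representatives. -/
theorem quotientDist_same (ℓ : LengthFunction Γ) (n : ℕ) (x y : Γ) :
    b.quotientDist ℓ (b.pt n x) (b.pt n y) =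
      ⨅ (g : Γ) (h : Γ) (_ : b.pt n g = b.pt n x) (_ : b.pt n h = b.pt n y),
        ENNReal.ofReal (ℓ (g * h⁻¹)) := by
  refine le_antisymm ?_ ?_
  · refine le_iInf fun g => le_iInf fun h => le_iInf fun hg => le_iInf fun hh => ?_
    refine iInf₂_le_of_le (g * h⁻¹) ?_ le_rfl
    rw [← hg, ← hh, smul_pt, inv_mul_cancel_right]
  · refine le_iInf fun γ => le_iInf fun hγ => ?_
    rw [smul_pt] at hγ
    refine iInf_le_of_le (γ * y) (iInf_le_of_le y (iInf_le_of_le hγ (iInf_le_of_le rfl ?_)))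
    rw [mul_inv_cancel_right]

/-- Different quotients are at infinite distance. -/
theorem quotientDist_ne (ℓ : LengthFunction Γ) {m n : ℕ} (hmn : m ≠ n) (g h : Γ) :
    b.quotientDist ℓ (b.pt m g) (b.pt n h) = ⊤ := by
  refine iInf_eq_top.2 fun γ => iInf_eq_top.2 fun hγ => ?_
  exact absurd (congrArg Sigma.fst hγ).symm hmn

/-- The (pseudo)metric on the box space determined by a length function. -/
abbrev quotientMetric (ℓ : LengthFunction Γ) : PseudoEMetricSpace b.Carrier where
  edist := b.quotientDist ℓ
  edist_self x := by
    refine le_antisymm ((iInf₂_le (1 : Γ) (one_smul Γ x)).trans ?_) bot_le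
    simp [ℓ.map_one]
  edist_comm := by
    have h : ∀ x y, b.quotientDist ℓ x y ≤ b.quotientDist ℓ y x := by
      intro x y
      refine le_iInf fun γ => le_iInf fun hγ => ?_
      refine iInf₂_le_of_le γ⁻¹ (by rw [← hγ, inv_smul_smul]) ?_
      rw [ℓ.map_inv]
    exact fun x y => le_antisymm (h x y) (h y x)
  edist_triangle x y z := by
    unfold quotientDist
    simp only [ENNReal.iInf_add, ENNReal.add_iInf]
    refine le_iInf fun γ => le_iInf fun hγ => le_iInf fun γ' => le_iInf fun hγ' => ?_
    refine iInf₂_le_of_le (γ' * γ) (by rw [mul_smul, hγ, hγ']) ?_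
    rw [← ENNReal.ofReal_add (ℓ.nonneg _) (ℓ.nonneg _)]
    exact ENNReal.ofReal_le_ofReal (ℓ.map_mul_le _ _)

/-- Points at distance at most `R` are translates of each other by an element of length at most
`R + 1`. -/
theorem exists_smul_eq {ℓ : LengthFunction Γ} {R : ℝ≥0} {x y : b.Carrier}
    (h : b.quotientDist ℓ x y ≤ R) : ∃ γ : Γ, ℓ γ ≤ R + 1 ∧ γ • y = x := by
  have h1 : b.quotientDist ℓ x y < ((R + 1 : ℝ≥0) : ℝ≥0∞) :=
    h.trans_lt (by exact_mod_cast lt_add_one R)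
  obtain ⟨γ, h2⟩ := iInf_lt_iff.1 h1
  obtain ⟨hγ, h3⟩ := iInf_lt_iff.1 h2
  refine ⟨γ, ?_, hγ⟩
  rw [ENNReal.ofReal_lt_coe_iff (ℓ.nonneg γ)] at h3
  exact_mod_cast h3.le

/-- The box space is an extended metric space, with the quotient metric of its proper length
function. -/
instance : EMetricSpace b.Carrier where
  __ := b.quotientMetric b.length
  eq_of_edist_eq_zero {x y} h := by
    have h0 : b.quotientDist b.length x y = 0 := h
    by_contra hne
    have hfin := b.proper 1
    have hpos : ∀ γ ∈ hfin.toFinset, γ • y = x → 0 < b.length γ := by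
      intro γ _ hγ
      refine lt_of_le_of_ne (b.length.nonneg γ) fun h' => hne ?_
      rw [← hγ, b.eq_one_of_length_eq_zero γ h'.symm, one_smul]
    obtain ⟨ε, hε, hlt⟩ : ∃ ε : ℝ, 0 < ε ∧ ∀ γ ∈ hfin.toFinset, γ • y = x → ε < b.length γ := by
      generalize hfin.toFinset = F at hpos
      induction F using Finset.cons_induction with
      | empty => exact ⟨1, one_pos, by simp⟩
      | cons a F ha ih =>
        obtain ⟨ε, hε, hF⟩ := ih fun γ hγ => hpos γ (Finset.mem_cons_of_mem hγ)
        by_cases hay : a • y = x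
        · have hpa := hpos a (Finset.mem_cons_self a F) hay
          refine ⟨min ε (b.length a / 2), lt_min hε (half_pos hpa), fun γ hγ hx => ?_⟩
          rcases Finset.mem_cons.1 hγ with rfl | hγ
          · exact (min_le_right _ _).trans_lt (by linarith)
          · exact (min_le_left _ _).trans_lt (hF γ hγ hx)
        · refine ⟨ε, hε, fun γ hγ hx => ?_⟩
          rcases Finset.mem_cons.1 hγ with rfl | hγ
          · exact absurd hx hay
          · exact hF γ hγ hx
    have hlt' : b.quotientDist b.length x y < ENNReal.ofReal (min ε 1) := by
      rw [h0, ENNReal.ofReal_pos]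
      positivity
    obtain ⟨γ, h2⟩ := iInf_lt_iff.1 hlt'
    obtain ⟨hγ, h3⟩ := iInf_lt_iff.1 h2
    rw [ENNReal.ofReal_lt_ofReal_iff (by positivity)] at h3
    have hmem : γ ∈ hfin.toFinset := hfin.mem_toFinset.2 (h3.le.trans (min_le_right _ _))
    exact absurd (h3.trans_le (min_le_left _ _)) (not_lt.2 (hlt γ hmem hγ).le)

theorem edist_def (x y : b.Carrier) : edist x y = b.quotientDist b.length x y := rfl

instance : BoundedGeometry b.Carrier where
  exists_bound R := by
    have hfin := b.proper (R + 1)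
    refine ⟨hfin.toFinset.card, fun x => ?_⟩
    have hsub : {y : b.Carrier | edist x y ≤ R} ⊆ (fun γ : Γ => γ⁻¹ • x) '' hfin.toFinset := by
      intro y hy
      obtain ⟨γ, hγ, hx⟩ := b.exists_smul_eq hy
      refine ⟨γ, by simpa using hγ, ?_⟩
      change γ⁻¹ • x = y
      rw [← hx, inv_smul_smul]
    refine (Set.encard_le_encard hsub).trans ((Set.encard_image_le _ _).trans ?_)
    rw [Set.encard_coe_eq_coe_finsetCard]

/-- The metric on the box space determined by an arbitrary length function; it is finer than the
metric of the box space. -/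
def lengthMetric (ℓ : LengthFunction Γ) : FinerMetric b.Carrier where
  metric := b.quotientMetric ℓ
  bornologous R := by
    have hfin := b.proper (R + 1)
    obtain ⟨C, hC⟩ : ∃ C : ℝ≥0, ∀ γ ∈ hfin.toFinset, ENNReal.ofReal (ℓ γ) ≤ C :=
      ⟨hfin.toFinset.sup fun γ => (ℓ γ).toNNReal, fun γ hγ =>
        ENNReal.coe_le_coe.2 (Finset.le_sup (f := fun γ => (ℓ γ).toNNReal) hγ)⟩
    refine ⟨C, fun x y h => ?_⟩
    obtain ⟨γ, hγ, hx⟩ := b.exists_smul_eq h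
    exact (iInf₂_le γ hx).trans (hC γ (hfin.mem_toFinset.2 hγ))

/-- The set of all metrics on the box space that are determined by a length function on `Γ`. -/
def lengthMetrics : Set (FinerMetric b.Carrier) := Set.range b.lengthMetric

end BoxSpace

end GeomT

end

/-! From group to space: left translation by `g` permutes every quotient `Γ / Nₙ`, so `ℂΓ` maps into
`ℂ_u[X]` by permutation matrices, and that of `g` has `δ_ℓ`-propagation at most `ℓ g`. Restricting a
representation of `ℂ_u[X]` along this homomorphism keeps `s` and `c`. It also keeps the invariant
vectors, because a partial translation is a finite disjoint union of restricted translations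
(`roeInvariants_eq`). Hence a Kazhdan projection of the group is carried to one of every box space.

From space to group: adding to `ℓ` the proper length of the box space gives a proper length that
vanishes only at the identity and admits at least the same representations. Matrices are sent to
`ℂΓ` by averaging along diagonals: the coefficient of `avgMap T` at `g` is the limit along an
ultrafilter of the mean of `T_{gx,x}` over `Γ / Nₙ`. This map is not multiplicative, but it is
realised by matrix coefficients. Given a representation `π` of `Γ` on `B`, let `T` act on `ℓ²(Γ /
Nₙ, B)` by the operator matrix `T_{xy} π(g_{xy})`, where `g_{xy}` is a shortest element moving `y`
to `x`. On a bounded scale `g_{xy} g_{yz} = g_{xz}` for large `n`, since `Nₙ` eventually contains no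
nontrivial element of bounded length. So the ultraproduct over `n` carries a genuine representation
`ρ` of `ℂ_u[X]`, with the same `s` and `c`. For normalised constant vectors `J v` and normalised
sums `m φ` one gets `m φ (ρ T (J v)) = φ (π (avgMap T) v)` (`exists_twisted_rep`). This identity
makes `avgMap` contractive, passes to the completions, and turns the projection property of `ρ(p)`
into that of the image of `p` under `π`.

Selfadjointness travels along both maps because the involutions are continuous: `a ↦ π(a*)*` on the
conjugate dual space is again a representation of the class (`ConjDualStable`). -/

noncomputable section

namespace GeomT

universe u v w w'

/-! ## The completed algebras -/

namespace RepClass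

variable {A : Type w} [Ring A] [Algebra ℂ A] (R : RepClass.{u, w} A)

theorem continuous_ext {B : BanachSp.{u}} (π : A →ₐ[ℂ] B.Op) : Continuous (R.ext π) :=
  UniformSpace.Completion.continuous_extension

section ext

variable {R} {B : BanachSp.{u}} {π : A →ₐ[ℂ] B.Op} (h : R.Mem B π)

include h

theorem ext_mul (a b : R.Alg) : R.ext π (a * b) = R.ext π a * R.ext π b := by
  induction a, b using UniformSpace.Completion.induction_on₂ with
  | hp =>
    refine isClosed_eq ((R.continuous_ext π).comp continuous_mul) ?_
    exact ((R.continuous_ext π).comp continuous_fst).mul ((R.continuous_ext π).comp continuous_snd)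
  | ih a b =>
    rw [← UniformSpace.Completion.coe_mul, R.ext_coe h, R.ext_coe h, R.ext_coe h]
    exact map_mul π _ _

theorem ext_sub (a b : R.Alg) : R.ext π (a - b) = R.ext π a - R.ext π b := by
  induction a, b using UniformSpace.Completion.induction_on₂ with
  | hp =>
    refine isClosed_eq ((R.continuous_ext π).comp continuous_sub) ?_
    exact ((R.continuous_ext π).comp continuous_fst).sub ((R.continuous_ext π).comp continuous_snd)
  | ih a b =>
    rw [← UniformSpace.Completion.coe_sub, R.ext_coe h, R.ext_coe h, R.ext_coe h]
    exact map_sub π _ _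

theorem norm_ext_le (a : R.Alg) : ‖R.ext π a‖ ≤ ‖a‖ := by
  induction a using UniformSpace.Completion.induction_on with
  | hp => exact isClosed_le (R.continuous_ext π).norm continuous_norm
  | ih a =>
    rw [R.ext_coe h, UniformSpace.Completion.norm_coe]
    exact R.norm_le h a

end ext

/-- The representations of the class separate the points of the completed algebra. -/
theorem eq_zero_of_ext {a : R.Alg}
    (h : ∀ (B : BanachSp.{u}) (π : A →ₐ[ℂ] B.Op), R.Mem B π → R.ext π a = 0) : a = 0 := by
  rw [← norm_le_zero_iff]
  refine le_of_forall_pos_le_add fun ε hε => ?_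
  -- Approximate `a` by an element `b` of the original algebra. There the norm is a supremum over
  -- the class, and `π(b) = π(b - a)` is small for each `π`.
  obtain ⟨b, hb⟩ := UniformSpace.Completion.denseRange_coe.exists_dist_lt a (half_pos hε)
  rw [dist_eq_norm] at hb
  have hbn : ‖(b : R.Alg)‖ ≤ ε / 2 := by
    rw [UniformSpace.Completion.norm_coe]
    refine R.seminorm_le (half_pos hε).le fun B π hπ => ?_
    have h1 := norm_ext_le hπ (a - b)
    rw [ext_sub hπ, h B π hπ, zero_sub, norm_neg, R.ext_coe hπ] at h1
    exact h1.trans hb.le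
  have := norm_add_le (a - (b : R.Alg)) (b : R.Alg)
  rw [sub_add_cancel] at this
  linarith

theorem eq_of_ext {a b : R.Alg}
    (h : ∀ (B : BanachSp.{u}) (π : A →ₐ[ℂ] B.Op), R.Mem B π → R.ext π a = R.ext π b) :
    a = b := by
  rw [← sub_eq_zero]
  refine R.eq_zero_of_ext fun B π hπ => ?_
  rw [ext_sub hπ, h B π hπ, sub_self]

/-! ### Contractive maps -/

section Map

variable {R} {A' : Type w'} [Ring A'] [Algebra ℂ A'] {R' : RepClass.{u, w'} A'}

/-- A map between algebras, regarded as a map between the seminormed algebras. -/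
def mapPre (R : RepClass.{u, w} A) (R' : RepClass.{u, w'} A') (Φ : A → A') : R.Pre → R'.Pre := Φ

/-- The extension to the completions of a map between algebras with representation classes. -/
def mapExt (R : RepClass.{u, w} A) (R' : RepClass.{u, w'} A') (Φ : A → A') : R.Alg → R'.Alg :=
  UniformSpace.Completion.map (mapPre R R' Φ)

theorem continuous_mapExt (Φ : A → A') : Continuous (mapExt R R' Φ) :=
  UniformSpace.Completion.continuous_map

theorem mapExt_coe {Φ : A → A'} (hsub : ∀ a b, Φ (a - b) = Φ a - Φ b)
    (hΦ : ∀ a, R'.seminorm (Φ a) ≤ R.seminorm a) (a : R.Pre) :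
    mapExt R R' Φ (a : R.Alg) = ((mapPre R R' Φ a : R'.Pre) : R'.Alg) := by
  refine UniformSpace.Completion.map_coe ?_ a
  refine (LipschitzWith.of_dist_le_mul (K := 1) ?_).uniformContinuous
  intro x y
  rw [NNReal.coe_one, one_mul, dist_eq_norm, dist_eq_norm]
  have h := hΦ ((show A from x) - (show A from y))
  rw [hsub] at h
  exact h

end Map

/-! ### The involution -/

/-- `star` is a conjugate linear unital antihomomorphism. -/
structure _root_.GeomT.IsAlgInvolution (A : Type w) [Ring A] [Algebra ℂ A] [Star A] : Prop where
  add : ∀ a b : A, star (a + b) = star a + star b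
  mul : ∀ a b : A, star (a * b) = star b * star a
  smul : ∀ (z : ℂ) (a : A), star (z • a) = starRingEnd ℂ z • star a
  one : star (1 : A) = 1

theorem _root_.GeomT.IsAlgInvolution.sub [Star A] (hA : IsAlgInvolution A) (a b : A) :
    star (a - b) = star a - star b := by
  have h := hA.add a ((-1 : ℂ) • b)
  rw [hA.smul] at h
  simpa [sub_eq_add_neg] using h

section conjTranspose

variable {B D : BanachSp.{u}} (J : D.carrier ≃ₛₗᵢ[starRingEnd ℂ] StrongDual ℂ B.carrier)

/-- The transpose of an operator, acting on a copy of the conjugate of the dual space. -/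
def conjTranspose (S : B.Op) : D.Op :=
  LinearMap.mkContinuous
    { toFun := fun ξ => J.symm ((J ξ).comp S)
      map_add' := fun ξ η => by rw [map_add, ContinuousLinearMap.add_comp, map_add]
      map_smul' := fun z ξ => by
        rw [J.map_smulₛₗ, ContinuousLinearMap.smul_comp, J.symm.map_smulₛₗ]
        simp } ‖S‖ (fun ξ => by
      change ‖J.symm ((J ξ).comp S)‖ ≤ _
      rw [LinearIsometryEquiv.norm_map, mul_comm, ← J.norm_map ξ]
      exact ContinuousLinearMap.opNorm_comp_le _ _)

theorem conjTranspose_apply (S : B.Op) (ξ : D.carrier) :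
    conjTranspose J S ξ = J.symm ((J ξ).comp S) := rfl

/-- By Hahn–Banach the functionals `φ = J (J.symm φ)` norm the vectors `S x`, which gives the lower
bound. -/
theorem norm_conjTranspose (S : B.Op) : ‖conjTranspose J S‖ = ‖S‖ := by
  refine le_antisymm (LinearMap.mkContinuous_norm_le _ (norm_nonneg _) _) ?_
  refine ContinuousLinearMap.opNorm_le_bound _ (norm_nonneg _) fun x => ?_
  refine NormedSpace.norm_le_dual_bound ℂ _ (by positivity) fun φ => ?_
  have h : φ (S x) = J (conjTranspose J S (J.symm φ)) x := by
    rw [conjTranspose_apply]; simp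
  rw [h]
  refine (ContinuousLinearMap.le_opNorm _ _).trans ?_
  rw [J.norm_map]
  have h2 := (conjTranspose J S).le_opNorm (J.symm φ)
  rw [J.symm.norm_map] at h2
  calc _ ≤ (‖conjTranspose J S‖ * ‖φ‖) * ‖x‖ := by gcongr
    _ = _ := by ring

/-- The conjugate dual `a ↦ π(a*)*` of a representation. -/
def conjDualRep [Star A] (hA : IsAlgInvolution A) (π : A →ₐ[ℂ] B.Op) : A →ₐ[ℂ] D.Op :=
  AlgHom.ofLinearMap
    { toFun := fun a => conjTranspose J (π (star a))
      map_add' := fun a b => by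
        ext ξ
        simp only [conjTranspose_apply, hA.add, map_add, ContinuousLinearMap.comp_add,
          add_apply]
      map_smul' := fun z a => by
        ext ξ
        simp only [conjTranspose_apply, hA.smul, map_smul, ContinuousLinearMap.comp_smul,
          RingHom.id_apply, smul_apply, map_smulₛₗ]
        simp }
    (by
      ext ξ
      simp only [LinearMap.coe_mk, AddHom.coe_mk, conjTranspose_apply, hA.one, map_one]
      change J.symm (J ξ) = ξ
      simp)
    -- The involution and the transpose both reverse products, so their composite preserves them;
    -- likewise the two conjugations of scalars cancel.
    (fun a b => by
      ext ξ
      simp only [LinearMap.coe_mk, AddHom.coe_mk, mul_apply_eq_comp,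
        conjTranspose_apply, hA.mul, map_mul]
      simp only [LinearIsometryEquiv.apply_symm_apply]
      rfl)

theorem norm_conjDualRep [Star A] (hA : IsAlgInvolution A) (π : A →ₐ[ℂ] B.Op) (a : A) :
    ‖conjDualRep J hA π a‖ = ‖π (star a)‖ := norm_conjTranspose J _

end conjTranspose

/-- Every member of a family closed under duality and conjugation has its conjugate dual in the
family. -/
theorem _root_.GeomT.exists_conjDual {𝔅 : Set BanachSp.{u}} (hdual : ClosedUnderDuality 𝔅)
    (hconj : ClosedUnderConjugation 𝔅) {B : BanachSp.{u}} (hB : B ∈ 𝔅) :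
    ∃ D ∈ 𝔅, Nonempty (D.carrier ≃ₛₗᵢ[starRingEnd ℂ] StrongDual ℂ B.carrier) := by
  obtain ⟨C, hC, ⟨e⟩⟩ := hdual B hB
  obtain ⟨D, hD, ⟨f⟩⟩ := hconj C hC
  exact ⟨D, hD, ⟨f.trans e⟩⟩

/-- The class is stable under passing to (some model of) the conjugate dual representation. -/
def ConjDualStable [Star A] (hA : IsAlgInvolution A) : Prop :=
  ∀ (B : BanachSp.{u}) (π : A →ₐ[ℂ] B.Op), R.Mem B π → ∃ (D : BanachSp.{u})
    (J : D.carrier ≃ₛₗᵢ[starRingEnd ℂ] StrongDual ℂ B.carrier), R.Mem D (conjDualRep J hA π)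

variable {R} in
-- The norm of `π(a*)` is the norm of the conjugate dual representation at `a`, and that
-- representation belongs to the class.
theorem ConjDualStable.seminorm_star_le [Star A] {hA : IsAlgInvolution A}
    (h : R.ConjDualStable hA) (a : A) : R.seminorm (star a) ≤ R.seminorm a := by
  refine R.seminorm_le (R.seminorm_nonneg a) fun B π hπ => ?_
  obtain ⟨D, J, hD⟩ := h B π hπ
  rw [← norm_conjDualRep J hA]
  exact R.norm_le hD a

variable {R} in
-- The definition of `starExt` extends the involution only once the latter is uniformly continuous;
-- the seminorm bound supplies this.
theorem ConjDualStable.starExt_coe [Star A] {hA : IsAlgInvolution A}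
    (h : R.ConjDualStable hA) (a : R.Pre) :
    R.starExt (a : R.Alg) = ((R.starPre a : R.Pre) : R.Alg) :=
  mapExt_coe (R := R) (R' := R) (Φ := fun a : A => star a) hA.sub h.seminorm_star_le a

theorem continuous_starExt [Star A] : Continuous R.starExt :=
  UniformSpace.Completion.continuous_map

/-- A contractive `*`-preserving additive map transports Kazhdan projections, as soon as the image
acts as a projection onto the invariant vectors. -/
theorem IsKazhdanProjection.map {R} {A' : Type w'} [Ring A'] [Algebra ℂ A'] [Star A] [Star A']
    {R' : RepClass.{u, w'} A'} {hA : IsAlgInvolution A} {hA' : IsAlgInvolution A'}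
    (hR : R.ConjDualStable hA) (hR' : R'.ConjDualStable hA')
    {inv : (B : BanachSp.{u}) → (A →ₐ[ℂ] B.Op) → Submodule ℂ B.carrier}
    {inv' : (B : BanachSp.{u}) → (A' →ₐ[ℂ] B.Op) → Submodule ℂ B.carrier}
    {p : R.Alg} (hp : R.IsKazhdanProjection inv p)
    {Φ : A → A'} (hsub : ∀ a b, Φ (a - b) = Φ a - Φ b)
    (hstar : ∀ a, Φ (star a) = star (Φ a))
    (hΦ : ∀ a, R'.seminorm (Φ a) ≤ R.seminorm a)
    (hproj : ∀ (B : BanachSp.{u}) (π : A' →ₐ[ℂ] B.Op), R'.Mem B π →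
      LinearMap.IsProj (inv' B π) (R'.ext π (mapExt R R' Φ p))) :
    R'.IsKazhdanProjection inv' (mapExt R R' Φ p) where
  idempotent := by
    -- The map `Φ` need not be multiplicative, so idempotency is not inherited from `p`. It is
    -- checked in each representation, where the image acts as a projection.
    refine R'.eq_of_ext fun B π hπ => ?_
    rw [ext_mul hπ]
    ext ξ
    exact (hproj B π hπ).map_id _ ((hproj B π hπ).map_mem ξ)
  selfadjoint := by
    have key : ∀ a : R.Alg, R'.starExt (mapExt R R' Φ a) = mapExt R R' Φ (R.starExt a) := by
      intro a
      induction a using UniformSpace.Completion.induction_on with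
      | hp =>
        exact isClosed_eq (R'.continuous_starExt.comp (continuous_mapExt Φ))
          ((continuous_mapExt Φ).comp R.continuous_starExt)
      | ih a =>
        rw [hR.starExt_coe, mapExt_coe hsub hΦ, mapExt_coe hsub hΦ, hR'.starExt_coe]
        exact congrArg (fun b : R'.Pre => (b : R'.Alg)) (hstar a).symm
    rw [key, hp.selfadjoint]
  isProj := hproj

end RepClass

/-! ## The involutions of the group algebra and of the Roe algebra -/

section Groups

variable {Γ : Type v} [Group Γ]

theorem star_single (g : Γ) (z : ℂ) :
    star (MonoidAlgebra.single g z) = MonoidAlgebra.single g⁻¹ (starRingEnd ℂ z) := by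
  classical
  ext h
  rw [star_coeff]
  simp only [MonoidAlgebra.coeff_single, Finsupp.single_apply, eq_comm]
  split_ifs <;> simp_all

theorem star_of (g : Γ) :
    star (MonoidAlgebra.of ℂ Γ g) = MonoidAlgebra.of ℂ Γ g⁻¹ := by
  rw [MonoidAlgebra.of_apply, star_single, map_one, MonoidAlgebra.of_apply]

theorem monoidAlgebra_isAlgInvolution : IsAlgInvolution (MonoidAlgebra ℂ Γ) := by
  have add : ∀ a b : MonoidAlgebra ℂ Γ, star (a + b) = star a + star b := by
    intro a b
    ext g
    simp [star_coeff]
  have smul : ∀ (z : ℂ) (a : MonoidAlgebra ℂ Γ), star (z • a) = starRingEnd ℂ z • star a := by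
    intro z a
    ext g
    simp [star_coeff]
  refine ⟨add, fun a b => ?_, smul, ?_⟩
  · induction a using MonoidAlgebra.induction_on with
    | of g =>
      induction b using MonoidAlgebra.induction_on with
      | of h => rw [← map_mul, star_of, star_of, star_of, mul_inv_rev, map_mul]
      | add b c hb hc => rw [mul_add, add, hb, hc, add, add_mul]
      | smul z b hb => rw [mul_smul_comm, smul, hb, smul, smul_mul_assoc]
    | add a c ha hc => rw [add_mul, add, ha, hc, add, mul_add]
    | smul z a ha => rw [smul_mul_assoc, smul, ha, smul, mul_smul_comm]
  · rw [← map_one (MonoidAlgebra.of ℂ Γ), star_of, inv_one]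

/-- The growth condition is symmetric under `g ↦ g⁻¹`, because `ℓ` is. -/
theorem groupReps_conjDualStable {𝔅 : Set BanachSp.{u}} (hdual : ClosedUnderDuality 𝔅)
    (hconj : ClosedUnderConjugation 𝔅) (ℓ : LengthFunction Γ) (s c : ℝ) :
    (groupReps 𝔅 ℓ s c).ConjDualStable monoidAlgebra_isAlgInvolution := by
  intro B π hπ
  obtain ⟨D, hD, ⟨J⟩⟩ := exists_conjDual hdual hconj hπ.1
  refine ⟨D, J, hD, fun g => ?_⟩
  rw [RepClass.norm_conjDualRep, star_of, ← ℓ.map_inv g]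
  exact hπ.2 g⁻¹

end Groups

section Roe

variable {X : Type v} [EMetricSpace X] [BoundedGeometry X]

theorem roe_ext {S T : UniformRoe X} (h : ∀ x y, entry S.1 x y = entry T.1 x y) : S = T :=
  Subtype.ext (entry_ext h)

theorem entry_star (T : UniformRoe X) (x y : X) :
    entry (star T).1 x y = starRingEnd ℂ (entry T.1 y x) :=
  entry_ofMatrix _ _ x y

theorem entry_add (S T : UniformRoe X) (x y : X) :
    entry (S + T).1 x y = entry S.1 x y + entry T.1 x y := rfl

theorem entry_sub (S T : UniformRoe X) (x y : X) :
    entry (S - T).1 x y = entry S.1 x y - entry T.1 x y := by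
  rw [eq_sub_iff_add_eq, ← entry_add, sub_add_cancel]

theorem entry_smul (z : ℂ) (T : UniformRoe X) (x y : X) :
    entry (z • T).1 x y = z * entry T.1 x y := rfl

theorem entry_one [DecidableEq X] (x y : X) :
    entry (1 : UniformRoe X).1 x y = if x = y then 1 else 0 := by
  change (Finsupp.single y (1 : ℂ)) x = _
  rw [Finsupp.single_apply]
  simp only [eq_comm]

/-- The entries of a product, as a sum over any finite set of indices that carries it. -/
theorem entry_mul_eq_sum (S T : UniformRoe X) (x z : X) (F : Finset X)
    (hF : ∀ y, entry S.1 x y ≠ 0 → entry T.1 y z ≠ 0 → y ∈ F) :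
    entry (S * T).1 x z = ∑ y ∈ F, entry S.1 x y * entry T.1 y z := by
  classical
  have h : entry (S * T).1 x z = _ := entry_mul S.1 T.1 x z
  rw [h]
  have h1 : ∀ y, entry T.1 y z ≠ 0 → y ∈ (T.1 (Finsupp.single z 1)).support := fun y hy =>
    Finsupp.mem_support_iff.2 hy
  refine (Finset.sum_subset Finset.subset_union_left (s₂ := _ ∪ F) ?_).trans
    ((Finset.sum_congr rfl fun y _ => mul_comm _ _).trans
      (Finset.sum_subset Finset.subset_union_right ?_).symm)
  · intro y _ hy
    rw [not_not.1 fun hne => hy (h1 y hne), zero_mul]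
  · intro y _ hy
    by_contra hne
    exact hy (hF y (left_ne_zero_of_mul hne) (right_ne_zero_of_mul hne))

theorem uniformRoe_isAlgInvolution : IsAlgInvolution (UniformRoe X) := by
  classical
  refine ⟨fun a b => ?_, fun a b => ?_, fun z a => ?_, ?_⟩ <;> refine roe_ext fun x y => ?_
  · simp only [entry_star, entry_add, map_add]
  · have hfin := (isRoeMatrix_entry b).column_finite x
    rw [entry_star, entry_mul_eq_sum a b y x hfin.toFinset (fun z _ hz => by simpa using hz),
      entry_mul_eq_sum (star b) (star a) x y hfin.toFinset
        (fun z hz _ => by simpa [entry_star] using hz), map_sum]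
    refine Finset.sum_congr rfl fun z _ => ?_
    rw [entry_star, entry_star, map_mul, mul_comm]
  · simp only [entry_star, entry_smul, map_mul]
  · rw [entry_star, entry_one, entry_one]
    simp only [eq_comm]
    split_ifs <;> simp

theorem IsPartialTranslation.star {V : UniformRoe X} (hV : IsPartialTranslation V) :
    IsPartialTranslation (star V) where
  zero_or_one x y := by
    rw [entry_star]
    rcases hV.zero_or_one y x with h | h <;> simp [h]
  row x y y' h h' := hV.column y y' x (by simpa [entry_star] using h)
    (by simpa [entry_star] using h')
  column x x' y h h' := hV.row y x x' (by simpa [entry_star] using h)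
    (by simpa [entry_star] using h')

theorem FinerMetric.prop_star (δ : FinerMetric X) (V : UniformRoe X) :
    δ.prop (star V) = δ.prop V := by
  unfold FinerMetric.prop
  rw [iSup_comm]
  refine iSup_congr fun x => iSup_congr fun y => ?_
  rw [δ.metric.edist_comm y x]
  refine iSup_congr_Prop ?_ fun _ => rfl
  simp [entry_star]

theorem star_diagonal (f : X → ℂ) (hf : ∃ M : ℝ, ∀ x, ‖f x‖ ≤ M) :
    star (diagonal f hf) = diagonal (fun x => starRingEnd ℂ (f x)) (by simpa using hf) := by
  classical
  refine roe_ext fun x y => ?_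
  rw [entry_star, entry_diagonal, entry_diagonal]
  by_cases h : x = y
  · simp [h]
  · simp [h, Ne.symm h]

/-- The transpose of a partial translation is a partial translation of equal propagation, and
conjugation preserves the supremum norm on the diagonal. -/
theorem roeReps_conjDualStable {𝔅 : Set BanachSp.{u}} (hdual : ClosedUnderDuality 𝔅)
    (hconj : ClosedUnderConjugation 𝔅) (δ : FinerMetric X) (s c : ℝ) :
    (roeReps 𝔅 δ s c).ConjDualStable uniformRoe_isAlgInvolution := by
  intro B π hπ
  obtain ⟨D, hD, ⟨J⟩⟩ := exists_conjDual hdual hconj hπ.1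
  refine ⟨D, J, hD, ?_, fun V hV => ?_⟩
  · obtain ⟨K, hK⟩ := hπ.2.1
    refine ⟨K, fun f M hf => ?_⟩
    rw [RepClass.norm_conjDualRep, star_diagonal]
    exact hK _ M (by simpa using hf)
  · rw [RepClass.norm_conjDualRep, ← δ.prop_star]
    exact hπ.2.2 _ hV.star

end Roe

/-! ### Restriction of representations, and the group algebra inside the Roe algebra. -/

theorem RepClass.ext_mapExt {A : Type w} [Ring A] [Algebra ℂ A] {A' : Type w'} [Ring A']
    [Algebra ℂ A'] {R : RepClass.{u, w} A} {R' : RepClass.{u, w'} A'} (Φ : A →ₐ[ℂ] A')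
    (hΦ : ∀ a, R'.seminorm (Φ a) ≤ R.seminorm a) {B : BanachSp.{u}} {π : A' →ₐ[ℂ] B.Op}
    (h' : R'.Mem B π) (h : R.Mem B (π.comp Φ)) (a : R.Alg) :
    R'.ext π (RepClass.mapExt R R' Φ a) = R.ext (π.comp Φ) a := by
  induction a using UniformSpace.Completion.induction_on with
  | hp =>
    exact isClosed_eq ((R'.continuous_ext π).comp (RepClass.continuous_mapExt Φ))
      (R.continuous_ext _)
  | ih a =>
    rw [RepClass.mapExt_coe (map_sub Φ) hΦ, R'.ext_coe h', R.ext_coe h]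
    rfl

section Roe

variable {X : Type v} [EMetricSpace X] [BoundedGeometry X]

theorem entry_sum {ι : Type*} (s : Finset ι) (W : ι → UniformRoe X) (x y : X) :
    entry (∑ i ∈ s, W i).1 x y = ∑ i ∈ s, entry (W i).1 x y := by
  classical
  induction s using Finset.induction_on with
  | empty => rfl
  | insert a s ha ih => rw [Finset.sum_insert ha, Finset.sum_insert ha, ← ih, entry_add]

theorem entry_chi (D : Set X) (x y : X) [Decidable (x = y)] [Decidable (x ∈ D)] :
    entry (chi D).1 x y = if x = y ∧ x ∈ D then 1 else 0 := by
  rw [chi, entry_diagonal]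
  by_cases h : x = y <;> by_cases h' : x ∈ D <;> simp_all

theorem entry_chi_mul (D : Set X) (T : UniformRoe X) (x y : X) [Decidable (x ∈ D)] :
    entry (chi D * T).1 x y = if x ∈ D then entry T.1 x y else 0 := by
  rw [chi, entry_diagonal_mul]
  by_cases h : x ∈ D <;> simp [h]

theorem chi_univ : chi (Set.univ : Set X) = 1 := by
  classical
  refine roe_ext fun x y => ?_
  rw [entry_chi, entry_one]
  simp

theorem FinerMetric.prop_le {δ : FinerMetric X} {T : UniformRoe X} {r : ℝ≥0∞}
    (h : ∀ x y, entry T.1 x y ≠ 0 → δ.metric.edist x y ≤ r) : δ.prop T ≤ r :=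
  iSup_le fun x => iSup_le fun y => iSup_le fun hxy => h x y hxy

theorem FinerMetric.edist_le_prop (δ : FinerMetric X) (T : UniformRoe X) {x y : X}
    (h : entry T.1 x y ≠ 0) : δ.metric.edist x y ≤ δ.prop T :=
  le_iSup₂_of_le x y (le_iSup_of_le h le_rfl)

end Roe

namespace BoxSpace

variable {Γ : Type v} [Group Γ] (b : BoxSpace Γ)

open Classical in
/-- The permutation matrix of the left translation by `g` on the box space. -/
def transl (g : Γ) : UniformRoe b.Carrier :=
  ofMatrix (fun x y => if x = g • y then 1 else 0) (by
    refine ⟨⟨1, fun x y => by split_ifs <;> simp⟩, ⟨(b.length g).toNNReal, fun x y h => ?_⟩⟩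
    have hx : x = g • y := by by_contra hne; exact h (if_neg hne)
    exact iInf₂_le_of_le g hx.symm le_rfl)

theorem entry_transl (g : Γ) (x y : b.Carrier) [Decidable (x = g • y)] :
    entry (b.transl g).1 x y = if x = g • y then 1 else 0 := by
  refine (entry_ofMatrix _ _ x y).trans ?_
  congr

theorem entry_transl_ne_zero {g : Γ} {x y : b.Carrier} :
    entry (b.transl g).1 x y ≠ 0 ↔ x = g • y := by
  classical
  rw [entry_transl]
  simp

theorem isPartialTranslation_transl (g : Γ) : IsPartialTranslation (b.transl g) where
  zero_or_one x y := by
    classical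
    rw [entry_transl]
    split_ifs <;> simp
  row x y y' h h' := by
    rw [entry_transl_ne_zero] at h h'
    exact smul_left_cancel g (h.symm.trans h')
  column x x' y h h' := by
    rw [entry_transl_ne_zero] at h h'
    exact h.trans h'.symm

theorem rangeOf_transl (g : Γ) : rangeOf (b.transl g) = Set.univ := by
  refine Set.eq_univ_of_forall fun x => ⟨g⁻¹ • x, ?_⟩
  rw [entry_transl_ne_zero, smul_inv_smul]

theorem prop_transl_le (ℓ : LengthFunction Γ) (g : Γ) :
    ((b.lengthMetric ℓ).prop (b.transl g)).toReal ≤ ℓ g := by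
  refine ENNReal.toReal_le_of_le_ofReal (ℓ.nonneg g) ?_
  refine FinerMetric.prop_le fun x y h => ?_
  rw [entry_transl_ne_zero] at h
  exact iInf₂_le_of_le g h.symm le_rfl

theorem transl_one : b.transl 1 = 1 := by
  classical
  refine roe_ext fun x y => ?_
  rw [entry_transl, entry_one, one_smul]

theorem transl_mul (g h : Γ) : b.transl (g * h) = b.transl g * b.transl h := by
  classical
  refine roe_ext fun x y => ?_
  rw [entry_mul_eq_sum (b.transl g) (b.transl h) x y {h • y} (fun z _ hz => by
    rw [entry_transl_ne_zero] at hz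
    rw [hz, Finset.mem_singleton]), Finset.sum_singleton, entry_transl, entry_transl,
    entry_transl, if_pos rfl, mul_one, mul_smul]

theorem star_transl (g : Γ) : star (b.transl g) = b.transl g⁻¹ := by
  classical
  refine roe_ext fun x y => ?_
  rw [entry_star, entry_transl, entry_transl, eq_comm (a := y), ← eq_inv_smul_iff]
  split_ifs <;> simp

/-- The representation of the group algebra in the Roe algebra by permutation matrices. -/
def translHom : MonoidAlgebra ℂ Γ →ₐ[ℂ] UniformRoe b.Carrier :=
  MonoidAlgebra.lift ℂ (UniformRoe b.Carrier) Γ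
    { toFun := b.transl, map_one' := b.transl_one, map_mul' := b.transl_mul }

theorem translHom_of (g : Γ) : b.translHom (MonoidAlgebra.of ℂ Γ g) = b.transl g :=
  MonoidAlgebra.lift_of _ _

theorem translHom_star (a : MonoidAlgebra ℂ Γ) : b.translHom (star a) = star (b.translHom a) := by
  induction a using MonoidAlgebra.induction_on with
  | of g => rw [star_of, translHom_of, translHom_of, star_transl]
  | add a c ha hc =>
    rw [monoidAlgebra_isAlgInvolution.add, map_add, map_add, uniformRoe_isAlgInvolution.add, ha, hc]
  | smul z a ha =>
    rw [monoidAlgebra_isAlgInvolution.smul, map_smul, map_smul, uniformRoe_isAlgInvolution.smul, ha]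

theorem mem_groupReps_comp_translHom {𝔅 : Set BanachSp.{u}} {ℓ : LengthFunction Γ} {s c : ℝ}
    (hs : 0 < s) (hc : 0 < c) {B : BanachSp.{u}} {π : UniformRoe b.Carrier →ₐ[ℂ] B.Op}
    (h : (roeReps 𝔅 (b.lengthMetric ℓ) s c).Mem B π) :
    (groupReps 𝔅 ℓ s c).Mem B (π.comp b.translHom) := by
  refine ⟨h.1, fun g => ?_⟩
  rw [AlgHom.comp_apply, translHom_of]
  refine (h.2.2 _ (b.isPartialTranslation_transl g)).trans ?_
  have := b.prop_transl_le ℓ g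
  gcongr

/-- A partial translation is a finite disjoint union of restrictions of left translations. -/
theorem exists_eq_sum_chi_mul_transl {V : UniformRoe b.Carrier} (hV : IsPartialTranslation V) :
    ∃ (F : Finset Γ) (D : Γ → Set b.Carrier), V = ∑ g ∈ F, chi (D g) * b.transl g ∧
      chi (rangeOf V) = ∑ g ∈ F, chi (D g) := by
  classical
  obtain ⟨R, hR⟩ := (isRoeMatrix_entry V).propagation
  -- The infimum defining the distance is only approximated, hence `R + 1`. The points with the same
  -- chosen `g` form `D g`, and properness leaves finitely many `g`. Off the range of `V` the choice
  -- is irrelevant.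
  have hex : ∀ x : b.Carrier, ∃ g : Γ, x ∈ rangeOf V →
      b.length g ≤ R + 1 ∧ entry V.1 x (g⁻¹ • x) ≠ 0 := by
    intro x
    by_cases hx : x ∈ rangeOf V
    · obtain ⟨y, hy⟩ := hx
      obtain ⟨g, hg, rfl⟩ := b.exists_smul_eq (hR x y hy)
      exact ⟨g, fun _ => ⟨hg, by rwa [inv_smul_smul]⟩⟩
    · exact ⟨1, fun h => absurd h hx⟩
  choose γ hγ using hex
  let F := (b.proper (R + 1)).toFinset
  have hF : ∀ x ∈ rangeOf V, γ x ∈ F := fun x hx => by simpa [F] using (hγ x hx).1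
  refine ⟨F, fun g => {x | x ∈ rangeOf V ∧ γ x = g}, roe_ext fun x y => ?_, roe_ext fun x y => ?_⟩
  · simp only [entry_sum, entry_chi_mul, entry_transl, Set.mem_ofPred_eq]
    by_cases hx : x ∈ rangeOf V
    · rw [Finset.sum_eq_single_of_mem (γ x) (hF x hx) (fun g _ hg => if_neg fun h => hg h.2.symm),
        if_pos ⟨hx, rfl⟩, eq_comm (a := x), ← eq_inv_smul_iff]
      have h1 := (hγ x hx).2
      split_ifs with hy
      · rw [hy]
        exact (hV.zero_or_one _ _).resolve_left h1
      · by_contra hne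
        exact hy (hV.row x y _ hne h1)
    · rw [Finset.sum_eq_zero fun g _ => if_neg fun h => hx h.1]
      by_contra hne
      exact hx ⟨y, hne⟩
  · simp only [entry_sum, entry_chi, Set.mem_ofPred_eq]
    by_cases hx : x ∈ rangeOf V
    · rw [Finset.sum_eq_single_of_mem (γ x) (hF x hx) (fun g _ hg => if_neg fun h => hg h.2.2.symm)]
      simp [hx]
    · rw [Finset.sum_eq_zero fun g _ => if_neg fun h => hx h.2.1, if_neg fun h => hx h.2]

/-- A full translation has range projection `1`, which gives one inclusion. For the other, write `V`
as a sum of `chi (D g) * transl g`: on a fixed vector each `transl g` may be dropped, and the `chi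
(D g)` sum to the range projection. -/
theorem roeInvariants_eq {B : BanachSp.{u}} (π : UniformRoe b.Carrier →ₐ[ℂ] B.Op) :
    roeInvariants B π = groupInvariants B (π.comp b.translHom) := by
  ext ξ
  refine ⟨fun h g => ?_, fun h V hV => ?_⟩
  · have h1 := h _ (b.isPartialTranslation_transl g)
    rw [rangeOf_transl, chi_univ, map_one] at h1
    rw [AlgHom.comp_apply, translHom_of]
    exact h1
  · obtain ⟨F, D, h1, h2⟩ := b.exists_eq_sum_chi_mul_transl hV
    rw [h2]
    conv_lhs => rw [h1]
    rw [map_sum, map_sum, sum_apply, sum_apply]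
    refine Finset.sum_congr rfl fun g _ => ?_
    have h3 := h g
    rw [AlgHom.comp_apply, translHom_of] at h3
    rw [map_mul, mul_apply_eq_comp, h3]

end BoxSpace

/-! ### From the group to its box spaces. -/

theorem StrongBanachT.geometricStrongBanachT {𝔅 : Set BanachSp.{u}} (hdual : ClosedUnderDuality 𝔅)
    (hconj : ClosedUnderConjugation 𝔅) {Γ : Type v} [Group Γ] (h : StrongBanachT 𝔅 Γ)
    (b : BoxSpace Γ) : GeometricStrongBanachT 𝔅 b.lengthMetrics := by
  rintro _ ⟨ℓ, rfl⟩
  obtain ⟨s, hs, hp⟩ := h ℓ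
  refine ⟨s, hs, fun c hc => ?_⟩
  obtain ⟨p, hp⟩ := hp c hc
  have hΦ : ∀ a, (roeReps 𝔅 (b.lengthMetric ℓ) s c).seminorm (b.translHom a) ≤
      (groupReps 𝔅 ℓ s c).seminorm a := fun a =>
    RepClass.seminorm_le _ (RepClass.seminorm_nonneg _ _) fun B π hπ =>
      RepClass.norm_le _ (b.mem_groupReps_comp_translHom hs hc hπ) a
  refine ⟨_, hp.map (groupReps_conjDualStable hdual hconj ℓ s c)
    (roeReps_conjDualStable hdual hconj _ s c) (map_sub b.translHom) b.translHom_star hΦ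
    fun B π hπ => ?_⟩
  have hπ' := b.mem_groupReps_comp_translHom hs hc hπ
  rw [RepClass.ext_mapExt b.translHom hΦ hπ hπ', b.roeInvariants_eq]
  exact hp.isProj B _ hπ'

/-! ## Existence of box spaces -/

section Existence

variable (Γ : Type v) [Group Γ] [Countable Γ]

open Pointwise in
/-- Every countable group has a proper length function that vanishes only at the identity. -/
theorem exists_proper_lengthFunction :
    ∃ ℓ : LengthFunction Γ, (∀ R : ℝ, {g : Γ | ℓ g ≤ R}.Finite) ∧ ∀ g, ℓ g = 0 → g = 1 := by
  obtain ⟨e, he⟩ := Countable.exists_injective_nat Γ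
  -- Symmetric, finite-to-one weights that are at least `1`; the length will be the least total
  -- weight of a word representing `g`.
  let w : Γ → ℕ := fun g => min (e g) (e g⁻¹) + 1
  have hw_inv : ∀ g, w g⁻¹ = w g := fun g => by simp only [w, inv_inv, min_comm]
  have hw_fin : ∀ n, {g | w g ≤ n}.Finite := by
    intro n
    have h1 : {g : Γ | e g ≤ n}.Finite := (Set.finite_Iic n).preimage he.injOn
    refine (h1.union h1.inv).subset fun g hg => ?_
    have hg' : min (e g) (e g⁻¹) ≤ n := (Nat.le_succ _).trans hg
    rcases min_le_iff.1 hg' with h | h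
    · exact Or.inl h
    · exact Or.inr h
  let S : Γ → Set ℕ := fun g => {n | ∃ l : List Γ, l.prod = g ∧ (l.map w).sum = n}
  have hS : ∀ g, (S g).Nonempty := fun g => ⟨_, [g], by simp, rfl⟩
  have hmem : ∀ g, ∃ l : List Γ, l.prod = g ∧ (l.map w).sum = sInf (S g) := fun g =>
    Nat.sInf_mem (hS g)
  have hle : ∀ l : List Γ, sInf (S l.prod) ≤ (l.map w).sum := fun l =>
    Nat.sInf_le ⟨l, rfl, rfl⟩
  have hinv : ∀ g, sInf (S g⁻¹) ≤ sInf (S g) := by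
    intro g
    obtain ⟨l, rfl, hl⟩ := hmem g
    rw [← hl, List.prod_inv_reverse]
    refine (hle _).trans_eq ?_
    rw [← List.map_reverse, List.map_map, List.map_reverse, List.sum_reverse]
    exact congrArg List.sum (List.map_congr_left fun g _ => hw_inv g)
  have hball : ∀ n, {g | sInf (S g) ≤ n}.Finite := by
    intro n
    induction n with
    | zero =>
      refine (Set.finite_singleton (1 : Γ)).subset fun g hg => ?_
      obtain ⟨l, rfl, hl⟩ := hmem g
      have h0 : (l.map w).sum = 0 := hl.trans (Nat.le_zero.1 hg)
      cases l with
      | nil => rfl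
      | cons a l => simp [w] at h0
    | succ n ih =>
      -- Splitting off the first letter, of weight at least `1`, leaves a word of weight at most
      -- `n`.
      refine ((Set.finite_singleton (1 : Γ)).union ((hw_fin (n + 1)).mul ih)).subset fun g hg => ?_
      obtain ⟨l, rfl, hl⟩ := hmem g
      have h0 : (l.map w).sum ≤ n + 1 := hl.le.trans hg
      cases l with
      | nil => exact Or.inl rfl
      | cons a l =>
        rw [List.map_cons, List.sum_cons] at h0
        have ha : 1 ≤ w a := Nat.le_add_left 1 _
        rw [List.prod_cons]
        refine Or.inr (Set.mul_mem_mul (show w a ≤ n + 1 by omega) ?_)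
        exact (hle l).trans (by omega)
  refine ⟨⟨fun g => ((sInf (S g) : ℕ) : ℝ), fun g => Nat.cast_nonneg _, ?_, fun g => ?_, fun g h => ?_⟩,
    fun R => ?_, fun g hg => ?_⟩
  · have := hle []
    simpa using this
  · have := hinv g⁻¹
    rw [inv_inv] at this
    rw [le_antisymm (hinv g) this]
  · obtain ⟨l, hl, hl'⟩ := hmem g
    obtain ⟨m, hm, hm'⟩ := hmem h
    have := hle (l ++ m)
    rw [List.prod_append, List.map_append, List.sum_append, hl, hm, hl', hm'] at this
    exact_mod_cast this
  · refine (hball ⌊R⌋₊).subset fun g hg => ?_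
    exact Nat.le_floor hg
  · have h0 : sInf (S g) = 0 := Nat.cast_eq_zero.1 (show ((sInf (S g) : ℕ) : ℝ) = 0 from hg)
    obtain ⟨l, rfl, hl⟩ := hmem g
    rw [h0] at hl
    cases l with
    | nil => rfl
    | cons a l => simp [w] at hl

/-- A countable residually finite group has a box space. -/
theorem nonempty_boxSpace [Group.ResiduallyFinite Γ] : Nonempty (BoxSpace Γ) := by
  obtain ⟨ℓ, hℓ, hℓ'⟩ := exists_proper_lengthFunction Γ
  obtain ⟨f, hf⟩ := exists_surjective_nat Γ
  have hH : ∀ g : Γ, ∃ H : FiniteIndexNormalSubgroup Γ, g ≠ 1 → g ∉ H := by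
    intro g
    by_cases hg : g = 1
    · exact ⟨.ofSubgroup ⊤, fun h => absurd hg h⟩
    · obtain ⟨H, hH⟩ := Group.exists_finiteIndexNormalSubgroup_notMem g hg
      exact ⟨H, fun _ => hH⟩
  choose H hH using hH
  refine ⟨⟨fun n => ⨅ k : Fin n, (H (f k)).toSubgroup, fun n => ?_, fun n => ?_, ?_, ?_, ℓ, hℓ, hℓ'⟩⟩
  · exact Subgroup.normal_iInf_normal fun k => (H (f k)).isNormal'
  · exact Subgroup.finiteIndex_iInf fun k => (H (f k)).isFiniteIndex'
  · intro m n hmn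
    exact le_iInf fun k => iInf_le_of_le (Fin.castLE hmn k) le_rfl
  · refine (Subgroup.eq_bot_iff_forall _).2 fun g hg => ?_
    obtain ⟨n, rfl⟩ := hf g
    by_contra hne
    refine hH (f n) hne ?_
    -- The `n`-th subgroup only intersects the indices below `n`, so `f n` is first excluded at
    -- stage `n + 1`.
    have h1 := (Subgroup.mem_iInf.1 hg (n + 1))
    exact Subgroup.mem_iInf.1 h1 ⟨n, Nat.lt_succ_self n⟩

end Existence

/-! ## Finite `ℓ²`-sums -/

section L2

open MeasureTheory

theorem norm_toLp_count {Ω : Type*} [MeasurableSpace Ω] [MeasurableSingletonClass Ω] [Fintype Ω]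
    {E : Type*} [NormedAddCommGroup E] (f : PiLp 2 fun _ : Ω => E)
    (hf : MemLp (fun x => f x) 2 (Measure.count : Measure Ω)) : ‖hf.toLp‖ = ‖f‖ := by
  rw [Lp.norm_toLp, eLpNorm_eq_lintegral_rpow_enorm_toReal two_ne_zero ENNReal.ofNat_ne_top,
    lintegral_count, tsum_fintype, PiLp.norm_eq_sum (by norm_num), ← ENNReal.toReal_rpow,
    ENNReal.toReal_sum (fun x _ => ENNReal.rpow_ne_top_of_nonneg (by norm_num) enorm_ne_top)]
  simp only [← ENNReal.toReal_rpow, toReal_enorm]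

/-- A finite `ℓ²`-sum is `L²` of counting measure. The index set is replaced by a lifted `Fin` so
that the measure space lies in the universe of the family. -/
theorem ClosedUnderL2.exists_piLp {𝔅 : Set BanachSp.{u}} (hL2 : ClosedUnderL2 𝔅)
    {B : BanachSp.{u}} (hB : B ∈ 𝔅) (ι : Type w) [Fintype ι] :
    ∃ C ∈ 𝔅, Nonempty (C.carrier ≃ₗᵢ[ℂ] PiLp 2 fun _ : ι => B.carrier) := by
  let Ω := ULift.{u} (Fin (Fintype.card ι))
  let _ : MeasurableSpace Ω := ⊤
  have _ : MeasurableSingletonClass Ω := ⟨fun _ => trivial⟩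
  obtain ⟨C, hC, ⟨e⟩⟩ := hL2 B hB Ω Measure.count
  have hmem : ∀ f : Ω → B.carrier, MemLp f 2 (Measure.count : Measure Ω) := fun f =>
    ⟨(StronglyMeasurable.of_discrete (f := f)).aestronglyMeasurable,
      eLpNorm_count_lt_top_of_lt fun i => enorm_lt_top⟩
  let L : (PiLp 2 fun _ : Ω => B.carrier) →ₗᵢ[ℂ] Lp B.carrier 2 (Measure.count : Measure Ω) :=
    { toFun := fun f => (hmem fun x => f x).toLp
      map_add' := fun f g => rfl
      map_smul' := fun z f => rfl
      norm_map' := fun f => norm_toLp_count f (hmem fun x => f x) }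
  have hL : Function.Surjective L := fun f => by
    refine ⟨WithLp.toLp 2 fun x => f x, Lp.ext ?_⟩
    exact MemLp.coeFn_toLp (hmem fun x => f x)
  exact ⟨C, hC, ⟨e.trans ((LinearIsometryEquiv.ofSurjective L hL).symm.trans
    (LinearIsometryEquiv.piLpCongrLeft 2 ℂ B.carrier
      (Equiv.ulift.trans (Fintype.equivFin ι).symm)))⟩⟩

end L2

/-! ## Conjugation of operators by an isometry -/

section Conj

variable {E F : Type*} [SeminormedAddCommGroup E] [NormedSpace ℂ E] [SeminormedAddCommGroup F]
  [NormedSpace ℂ F]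

/-- Conjugation by a linear isometry, as an algebra homomorphism. -/
def conjOp (e : E ≃ₗᵢ[ℂ] F) : (F →L[ℂ] F) →ₐ[ℂ] (E →L[ℂ] E) :=
  AlgHom.ofLinearMap
    { toFun := fun S => (e.symm.toContinuousLinearEquiv : F →L[ℂ] E).comp
        (S.comp (e.toContinuousLinearEquiv : E →L[ℂ] F))
      map_add' := fun S T => by ext; simp
      map_smul' := fun z S => by ext; simp }
    (by ext; simp) (fun S T => by ext; simp)

theorem conjOp_apply (e : E ≃ₗᵢ[ℂ] F) (S : F →L[ℂ] F) (x : E) :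
    conjOp e S x = e.symm (S (e x)) := rfl

theorem norm_conjOp_le (e : E ≃ₗᵢ[ℂ] F) (S : F →L[ℂ] F) : ‖conjOp e S‖ ≤ ‖S‖ := by
  refine ContinuousLinearMap.opNorm_le_bound _ (norm_nonneg _) fun x => ?_
  rw [conjOp_apply, LinearIsometryEquiv.norm_map, ← e.norm_map x]
  exact S.le_opNorm _

end Conj

/-! ## Operators on ultraproducts -/

section Ultraproduct

theorem exists_tendsto_ultrafilter (ω : Ultrafilter ℕ) {a : ℕ → ℂ} {C : ℝ} (h : ∀ n, ‖a n‖ ≤ C) :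
    ∃ z, Filter.Tendsto a ω (nhds z) := by
  obtain ⟨z, -, hz⟩ := (isCompact_closedBall (0 : ℂ) C).ultrafilter_le_nhds' (ω.map a)
    (Filter.mem_map.2 (Filter.mem_of_superset Filter.univ_mem fun n _ => by simpa using h n))
  exact ⟨z, hz⟩

/-- The limit of a bounded sequence along an ultrafilter. -/
def ulim (ω : Ultrafilter ℕ) (a : ℕ → ℂ) : ℂ := Filter.limUnder (ω : Filter ℕ) a

theorem tendsto_ulim (ω : Ultrafilter ℕ) {a : ℕ → ℂ} {C : ℝ} (h : ∀ n, ‖a n‖ ≤ C) :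
    Filter.Tendsto a ω (nhds (ulim ω a)) :=
  tendsto_nhds_limUnder (exists_tendsto_ultrafilter ω h)

theorem ulim_eq {ω : Ultrafilter ℕ} {a : ℕ → ℂ} {z : ℂ} (h : Filter.Tendsto a ω (nhds z)) :
    ulim ω a = z := h.limUnder_eq

variable {E : ℕ → BanachSp.{u}} {ω : Ultrafilter ℕ}

/-- A uniformly bounded sequence of operators acts on bounded sequences. -/
def lpOp (S : ∀ n, (E n).Op) (hS : ∃ C, ∀ n, ‖S n‖ ≤ C) :
    lp (fun n => (E n).carrier) ∞ →ₗ[ℂ] lp (fun n => (E n).carrier) ∞ where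
  toFun ξ := ⟨fun n => S n (ξ n), memℓp_infty (by
    obtain ⟨C, hC⟩ := hS
    refine ⟨C * ‖ξ‖, ?_⟩
    rintro _ ⟨n, rfl⟩
    exact (S n).le_of_opNorm_le_of_le (hC n) (lp.norm_apply_le_norm ENNReal.top_ne_zero ξ n))⟩
  map_add' ξ η := lp.ext (funext fun n => map_add (S n) (ξ n) (η n))
  map_smul' z ξ := lp.ext (funext fun n => map_smul (S n) z (ξ n))

theorem lpOp_apply (S : ∀ n, (E n).Op) (hS : ∃ C, ∀ n, ‖S n‖ ≤ C)
    (ξ : lp (fun n => (E n).carrier) ∞) (n : ℕ) : lpOp S hS ξ n = S n (ξ n) := rfl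

theorem norm_lpOp_le {S : ∀ n, (E n).Op} {hS : ∃ C, ∀ n, ‖S n‖ ≤ C} {C : ℝ} (hC0 : 0 ≤ C)
    (hC : ∀ n, ‖S n‖ ≤ C) (ξ : lp (fun n => (E n).carrier) ∞) : ‖lpOp S hS ξ‖ ≤ C * ‖ξ‖ := by
  refine lp.norm_le_of_forall_le (by positivity) fun n => ?_
  exact (S n).le_of_opNorm_le_of_le (hC n) (lp.norm_apply_le_norm ENNReal.top_ne_zero ξ n)

theorem mem_ultraNull {ξ : lp (fun n => (E n).carrier) ∞} :
    ξ ∈ ultraNull E ω ↔ Filter.Tendsto (fun n => ‖ξ n‖) ω (nhds 0) := Iff.rfl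

theorem ultraNull_le_comap (S : ∀ n, (E n).Op) (hS : ∃ C, ∀ n, ‖S n‖ ≤ C) :
    ultraNull E ω ≤ (ultraNull E ω).comap (lpOp S hS) := by
  intro ξ hξ
  obtain ⟨C, hC⟩ := hS
  rw [mem_ultraNull] at hξ
  rw [Submodule.mem_comap, mem_ultraNull]
  refine squeeze_zero (fun n => norm_nonneg _) (fun n => (S n).le_of_opNorm_le (hC n) (ξ n)) ?_
  simpa using hξ.const_mul C

theorem norm_le_of_forall_mk {G : Type*} [SeminormedAddCommGroup G]
    (T : Ultraproduct E ω → G) {C : ℝ} (hC0 : 0 ≤ C)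
    (h : ∀ ξ : lp (fun n => (E n).carrier) ∞, ‖T (Submodule.Quotient.mk ξ)‖ ≤ C * ‖ξ‖)
    (x : Ultraproduct E ω) : ‖T x‖ ≤ C * ‖x‖ := by
  refine le_of_forall_pos_le_add fun ε hε => ?_
  -- The quotient norm is an infimum over representatives. The excess is later multiplied by `C`,
  -- and `C + 1` avoids dividing by zero.
  obtain ⟨ξ, rfl, hξ⟩ := Submodule.Quotient.norm_mk_lt x (ε := ε / (C + 1)) (by positivity)
  refine (h ξ).trans ((mul_le_mul_of_nonneg_left hξ.le hC0).trans ?_)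
  rw [mul_add]
  have : C * (ε / (C + 1)) ≤ ε := by
    rw [mul_div_assoc', div_le_iff₀ (by positivity)]
    nlinarith
  linarith

variable (ω) in
/-- The operator induced on the ultraproduct by a uniformly bounded sequence of operators. -/
def ultraOp (S : ∀ n, (E n).Op) (hS : ∃ C, ∀ n, ‖S n‖ ≤ C) :
    Ultraproduct E ω →L[ℂ] Ultraproduct E ω :=
  LinearMap.mkContinuousOfExistsBound
    ((ultraNull E ω).mapQ (ultraNull E ω) (lpOp S hS) (ultraNull_le_comap S hS)) (by
      obtain ⟨C, hC⟩ := hS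
      have hC0 : 0 ≤ C := (norm_nonneg _).trans (hC 0)
      refine ⟨C, norm_le_of_forall_mk _ hC0 fun ξ => ?_⟩
      exact (Submodule.Quotient.norm_mk_le _ _).trans (norm_lpOp_le hC0 hC ξ))

theorem norm_ultraOp_le {S : ∀ n, (E n).Op} {hS : ∃ C, ∀ n, ‖S n‖ ≤ C} {C : ℝ} (hC0 : 0 ≤ C)
    (hC : ∀ n, ‖S n‖ ≤ C) : ‖ultraOp ω S hS‖ ≤ C := by
  refine ContinuousLinearMap.opNorm_le_bound _ hC0 (norm_le_of_forall_mk _ hC0 fun ξ => ?_)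
  exact (Submodule.Quotient.norm_mk_le _ _).trans (norm_lpOp_le hC0 hC ξ)

/-- This is how relations that hold only for large `n` become exact in the ultraproduct. -/
theorem ultraproduct_mk_eq {ξ η : lp (fun n => (E n).carrier) ∞}
    (h : ∀ᶠ n in (ω : Filter ℕ), ξ n = η n) :
    (Submodule.Quotient.mk ξ : Ultraproduct E ω) = Submodule.Quotient.mk η := by
  rw [Submodule.Quotient.eq, mem_ultraNull]
  refine tendsto_const_nhds.congr' (h.mono fun n hn => ?_)
  change 0 = ‖ξ n - η n‖
  rw [hn, sub_self, norm_zero]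

/-- An asymptotically multiplicative sequence of linear maps into operator algebras induces a
representation on the ultraproduct. -/
def ultraRep {A : Type w} [Ring A] [Algebra ℂ A] (ω : Ultrafilter ℕ) (σ : ∀ n, A →ₗ[ℂ] (E n).Op)
    (hb : ∀ a, ∃ C, ∀ n, ‖σ n a‖ ≤ C) (hone : ∀ᶠ n in (ω : Filter ℕ), σ n 1 = 1)
    (hmul : ∀ a b, ∀ᶠ n in (ω : Filter ℕ), σ n (a * b) = σ n a * σ n b) :
    A →ₐ[ℂ] (Ultraproduct E ω →L[ℂ] Ultraproduct E ω) :=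
  AlgHom.ofLinearMap
    { toFun := fun a => ultraOp ω (fun n => σ n a) (hb a)
      map_add' := fun a b => by
        refine ContinuousLinearMap.ext fun x => ?_
        obtain ⟨ξ, rfl⟩ := Submodule.Quotient.mk_surjective _ x
        refine ultraproduct_mk_eq (.of_forall fun n => ?_)
        simp [lpOp_apply]
      map_smul' := fun z a => by
        refine ContinuousLinearMap.ext fun x => ?_
        obtain ⟨ξ, rfl⟩ := Submodule.Quotient.mk_surjective _ x
        refine ultraproduct_mk_eq (.of_forall fun n => ?_)
        simp [lpOp_apply] }
    (by
      refine ContinuousLinearMap.ext fun x => ?_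
      obtain ⟨ξ, rfl⟩ := Submodule.Quotient.mk_surjective _ x
      refine ultraproduct_mk_eq (hone.mono fun n hn => ?_)
      simp [lpOp_apply, hn])
    (fun a b => by
      refine ContinuousLinearMap.ext fun x => ?_
      obtain ⟨ξ, rfl⟩ := Submodule.Quotient.mk_surjective _ x
      refine ultraproduct_mk_eq ((hmul a b).mono fun n hn => ?_)
      simp [lpOp_apply, hn])

/-- The limit of a bounded sequence of functionals, as a functional on the ultraproduct. -/
def ultraFunctional (ω : Ultrafilter ℕ) (φ : ∀ n, StrongDual ℂ (E n).carrier) (C : ℝ)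
    (hC : ∀ n, ‖φ n‖ ≤ C) : StrongDual ℂ (Ultraproduct E ω) :=
  have hb : ∀ (ξ : lp (fun n => (E n).carrier) ∞) (n : ℕ), ‖φ n (ξ n)‖ ≤ C * ‖ξ‖ := fun ξ n =>
    (φ n).le_of_opNorm_le_of_le (hC n) (lp.norm_apply_le_norm ENNReal.top_ne_zero ξ n)
  let L : lp (fun n => (E n).carrier) ∞ →ₗ[ℂ] ℂ :=
    { toFun := fun ξ => ulim ω fun n => φ n (ξ n)
      map_add' := fun ξ η => ulim_eq (by
        simpa using (tendsto_ulim ω (hb ξ)).add (tendsto_ulim ω (hb η)))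
      map_smul' := fun z ξ => ulim_eq (by
        simpa using (tendsto_ulim ω (hb ξ)).const_mul z) }
  LinearMap.mkContinuous ((ultraNull E ω).liftQ L (fun ξ hξ => by
      rw [mem_ultraNull] at hξ
      have h0 : Filter.Tendsto (fun n => C * ‖ξ n‖) ω (nhds 0) := by simpa using hξ.const_mul C
      exact ulim_eq (squeeze_zero_norm (fun n => (φ n).le_of_opNorm_le (hC n) (ξ n)) h0))) C
    (norm_le_of_forall_mk _ ((norm_nonneg _).trans (hC 0)) fun ξ =>
      le_of_tendsto' (tendsto_ulim ω (hb ξ)).norm (hb ξ))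

attribute [irreducible] ulim

theorem norm_ultraFunctional_le (φ : ∀ n, StrongDual ℂ (E n).carrier) (C : ℝ)
    (hC : ∀ n, ‖φ n‖ ≤ C) : ‖ultraFunctional ω φ C hC‖ ≤ C := by
  have hC0 : 0 ≤ C := (norm_nonneg _).trans (hC 0)
  refine ContinuousLinearMap.opNorm_le_bound _ hC0 (norm_le_of_forall_mk _ hC0 fun ξ => ?_)
  have hb : ∀ n : ℕ, ‖φ n (ξ n)‖ ≤ C * ‖ξ‖ := fun n =>
    (φ n).le_of_opNorm_le_of_le (hC n) (lp.norm_apply_le_norm ENNReal.top_ne_zero ξ n)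
  exact le_of_tendsto' (tendsto_ulim ω hb).norm hb

end Ultraproduct

/-! ### Components of a box space, shortest displacements and averages. -/

namespace BoxSpace

variable {Γ : Type v} [Group Γ] (b : BoxSpace Γ)

/-- The `n`-th component of the box space. -/
abbrev Comp (n : ℕ) : Type v := Γ ⧸ b.N n

instance (n : ℕ) : Finite (b.Comp n) :=
  have := b.finiteIndex n
  Subgroup.finite_quotient_of_finiteIndex

instance (n : ℕ) : Fintype (b.Comp n) := Fintype.ofFinite _

/-- A point of the `n`-th component, as a point of the box space. -/
def incl {n : ℕ} (x : b.Comp n) : b.Carrier := ⟨n, x⟩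

theorem incl_injective (n : ℕ) : Function.Injective (b.incl (n := n)) := fun x y h => by
  simpa [incl, Carrier] using h

theorem smul_incl {n : ℕ} (g : Γ) (x : b.Comp n) : g • b.incl x = b.incl (g • x) := rfl

/-- The stabilizer of a coset is a conjugate of `Nₙ`, hence `Nₙ` itself by normality. -/
theorem smul_eq_self_iff {n : ℕ} {g : Γ} {x : b.Comp n} : g • x = x ↔ g ∈ b.N n := by
  obtain ⟨h, rfl⟩ := QuotientGroup.mk_surjective x
  have := b.normal n
  change ((g * h : Γ) : b.Comp n) = h ↔ _
  rw [eq_comm, QuotientGroup.eq, (b.normal n).mem_comm_iff, mul_assoc, mul_inv_cancel, mul_one]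

theorem exists_smul_eq_comp {n : ℕ} (x y : b.Comp n) : ∃ g : Γ, g • y = x := by
  obtain ⟨h, rfl⟩ := QuotientGroup.mk_surjective x
  obtain ⟨k, rfl⟩ := QuotientGroup.mk_surjective y
  refine ⟨h * k⁻¹, ?_⟩
  change ((h * k⁻¹ * k : Γ) : b.Comp n) = h
  rw [inv_mul_cancel_right]

/-- Elements of small length are not in `Nₙ`, for large `n`. -/
theorem eventually_eq_one {ℓ : LengthFunction Γ} (hℓ : ∀ R : ℝ, {g : Γ | ℓ g ≤ R}.Finite)
    (R : ℝ) : ∀ᶠ n in Filter.atTop, ∀ g ∈ b.N n, ℓ g ≤ R → g = 1 := by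
  have h : ∀ g ∈ {g : Γ | ℓ g ≤ R}, ∀ᶠ n in Filter.atTop, g ∈ b.N n → g = 1 := by
    intro g _
    by_cases hg : g = 1
    · exact .of_forall fun n _ => hg
    · have h1 : g ∉ ⨅ n, b.N n := by rwa [b.iInf_eq_bot, Subgroup.mem_bot]
      rw [Subgroup.mem_iInf, not_forall] at h1
      obtain ⟨m, hm⟩ := h1
      filter_upwards [Filter.eventually_ge_atTop m] with n hn h2
      exact absurd (b.antitone hn h2) hm
  filter_upwards [(Filter.eventually_all_finite (hℓ R)).2 h] with n hn g hg hR
  exact hn g hR hg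

/-- Properness makes the infimum defining the quotient distance a minimum, so displacements lose no
additive constant in the growth bounds. -/
theorem exists_shortest {ℓ : LengthFunction Γ} (hℓ : ∀ R : ℝ, {g : Γ | ℓ g ≤ R}.Finite)
    {n : ℕ} (x y : b.Comp n) : ∃ g : Γ, g • y = x ∧ ∀ h : Γ, h • y = x → ℓ g ≤ ℓ h := by
  obtain ⟨g₀, hg₀⟩ := b.exists_smul_eq_comp x y
  obtain ⟨g, ⟨hg, hgx⟩, hmin⟩ := Set.exists_min_image ({g : Γ | ℓ g ≤ ℓ g₀} ∩ {g | g • y = x}) ℓ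
    ((hℓ _).inter_of_left _) ⟨g₀, by simp, hg₀⟩
  refine ⟨g, hgx, fun h hh => ?_⟩
  rcases le_total (ℓ h) (ℓ g₀) with h1 | h1
  · exact hmin h ⟨h1, hh⟩
  · exact le_trans hg h1

section Disp

variable {ℓ : LengthFunction Γ} (hℓ : ∀ R : ℝ, {g : Γ | ℓ g ≤ R}.Finite)

/-- A shortest group element that moves `y` to `x`. -/
def disp {n : ℕ} (x y : b.Comp n) : Γ := (b.exists_shortest hℓ x y).choose

theorem disp_smul {n : ℕ} (x y : b.Comp n) : b.disp hℓ x y • y = x :=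
  (b.exists_shortest hℓ x y).choose_spec.1

theorem disp_le {n : ℕ} {x y : b.Comp n} {g : Γ} (h : g • y = x) : ℓ (b.disp hℓ x y) ≤ ℓ g :=
  (b.exists_shortest hℓ x y).choose_spec.2 g h

theorem disp_self (hone : ∀ g, ℓ g = 0 → g = 1) {n : ℕ} (x : b.Comp n) : b.disp hℓ x x = 1 := by
  refine hone _ (le_antisymm ?_ (ℓ.nonneg _))
  rw [← ℓ.map_one]
  exact b.disp_le hℓ (one_smul _ x)

/-- In large components, every sufficiently short element is the displacement between any two points
that it connects. -/
theorem eventually_disp_eq (R : ℝ) : ∀ᶠ n in Filter.atTop, ∀ (x y : b.Comp n) (g : Γ),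
    g • y = x → ℓ g ≤ R → b.disp hℓ x y = g := by
  -- Two elements of length at most `R` that move `y` to `x` differ by an element of `Nₙ` of length
  -- at most `2R`.
  filter_upwards [b.eventually_eq_one hℓ (R + R)] with n hn x y g hg hR
  have h1 : (b.disp hℓ x y)⁻¹ * g ∈ b.N n := by
    rw [← smul_eq_self_iff (x := y), mul_smul, hg, inv_smul_eq_iff, disp_smul]
  refine inv_mul_eq_one.1 (hn _ h1 ((ℓ.map_mul_le _ _).trans ?_))
  rw [ℓ.map_inv]
  exact add_le_add ((b.disp_le hℓ hg).trans hR) hR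

theorem disp_le_prop {n : ℕ} {x y : b.Comp n} {T : UniformRoe b.Carrier}
    (h : entry T.1 (b.incl x) (b.incl y) ≠ 0) :
    ℓ (b.disp hℓ x y) ≤ ((b.lengthMetric ℓ).prop T).toReal := by
  rw [← ENNReal.ofReal_le_iff_le_toReal (FinerMetric.prop_lt_top _ T).ne]
  refine le_trans ?_ (FinerMetric.edist_le_prop (b.lengthMetric ℓ) T h)
  refine le_iInf fun g => le_iInf fun hg => ENNReal.ofReal_le_ofReal (b.disp_le hℓ ?_)
  exact b.incl_injective n hg

theorem eq_comp_of_entry_ne_zero {T : UniformRoe b.Carrier} {x y : b.Carrier}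
    (h : entry T.1 x y ≠ 0) : x.1 = y.1 := by
  obtain ⟨R, hR⟩ := (isRoeMatrix_entry T).propagation
  obtain ⟨g, -, rfl⟩ := b.exists_smul_eq (hR x y h)
  rfl

theorem entry_mul_incl (S T : UniformRoe b.Carrier) {n : ℕ} (x z : b.Comp n) :
    entry (S * T).1 (b.incl x) (b.incl z) =
      ∑ y : b.Comp n, entry S.1 (b.incl x) (b.incl y) * entry T.1 (b.incl y) (b.incl z) := by
  rw [entry_mul_eq_sum S T _ _ (Finset.univ.map ⟨b.incl, b.incl_injective n⟩), Finset.sum_map]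
  · rfl
  · rintro ⟨m, y⟩ h -
    obtain rfl : n = m := b.eq_comp_of_entry_ne_zero h
    exact Finset.mem_map_of_mem _ (Finset.mem_univ y)

/-! ### Averages along the diagonals -/

/-- The average over the `n`-th component of the entries `T_{gx, x}`. -/
def avg (n : ℕ) (T : UniformRoe b.Carrier) (g : Γ) : ℂ :=
  (Fintype.card (b.Comp n) : ℂ)⁻¹ * ∑ x : b.Comp n, entry T.1 (b.incl (g • x)) (b.incl x)

theorem card_comp_ne_zero (n : ℕ) : (Fintype.card (b.Comp n) : ℝ) ≠ 0 :=
  Nat.cast_ne_zero.2 Fintype.card_ne_zero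

theorem exists_norm_avg_le (T : UniformRoe b.Carrier) : ∃ M, ∀ n g, ‖b.avg n T g‖ ≤ M := by
  obtain ⟨M, hM⟩ := (isRoeMatrix_entry T).bounded
  refine ⟨M, fun n g => ?_⟩
  have h1 := norm_sum_le_of_le (Finset.univ : Finset (b.Comp n))
    fun x _ => hM (b.incl (g • x)) (b.incl x)
  rw [Finset.sum_const, Finset.card_univ, nsmul_eq_mul] at h1
  have h2 := b.card_comp_ne_zero n
  rw [avg, norm_mul, norm_inv, Complex.norm_natCast]
  refine (mul_le_mul_of_nonneg_left h1 (by positivity)).trans_eq ?_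
  rw [inv_mul_cancel_left₀ h2]

theorem tendsto_avg (ω : Ultrafilter ℕ) (T : UniformRoe b.Carrier) (g : Γ) :
    Filter.Tendsto (fun n => b.avg n T g) ω (nhds (ulim ω fun n => b.avg n T g)) := by
  obtain ⟨M, hM⟩ := b.exists_norm_avg_le T
  exact tendsto_ulim ω fun n => hM n g

theorem avg_sub (n : ℕ) (S T : UniformRoe b.Carrier) (g : Γ) :
    b.avg n (S - T) g = b.avg n S g - b.avg n T g := by
  simp only [avg, entry_sub, Finset.sum_sub_distrib, mul_sub]

theorem avg_star (n : ℕ) (T : UniformRoe b.Carrier) (g : Γ) :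
    b.avg n (star T) g = starRingEnd ℂ (b.avg n T g⁻¹) := by
  simp only [avg, entry_star, map_mul, map_inv₀, Complex.conj_natCast, map_sum]
  congr 1
  refine Fintype.sum_equiv (MulAction.toPerm g) _ _ fun x => ?_
  rw [MulAction.toPerm_apply, inv_smul_smul]

include hℓ in
-- For large `n`, `g` is the displacement from `x` to `g • x`, so a nonzero entry there would force
-- propagation at least `ℓ g`. Hence the limits of the averages have finite support.
theorem eventually_avg_eq_zero (T : UniformRoe b.Carrier) {g : Γ}
    (hg : ((b.lengthMetric ℓ).prop T).toReal < ℓ g) :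
    ∀ᶠ n in Filter.atTop, b.avg n T g = 0 := by
  filter_upwards [b.eventually_disp_eq hℓ (ℓ g)] with n hn
  rw [avg, Finset.sum_eq_zero, mul_zero]
  intro x _
  by_contra hne
  have h1 := b.disp_le_prop hℓ hne
  rw [hn _ x g rfl le_rfl] at h1
  exact absurd h1 (not_le.2 hg)

variable {ω : Ultrafilter ℕ} (hω : (ω : Filter ℕ) ≤ Filter.atTop)

include hω hℓ in
theorem ulim_avg_eq_zero (T : UniformRoe b.Carrier) {g : Γ}
    (hg : ((b.lengthMetric ℓ).prop T).toReal < ℓ g) : ulim ω (fun n => b.avg n T g) = 0 :=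
  ulim_eq (tendsto_const_nhds.congr'
    (((b.eventually_avg_eq_zero hℓ T hg).filter_mono hω).mono fun _ h => h.symm))

/-- The limit of the diagonal averages of a matrix, as an element of the group algebra. -/
def avgMap (T : UniformRoe b.Carrier) : MonoidAlgebra ℂ Γ :=
  MonoidAlgebra.ofCoeff (Finsupp.onFinset (hℓ ((b.lengthMetric ℓ).prop T).toReal).toFinset
    (fun g => ulim ω fun n => b.avg n T g) (fun g hg => by
      by_contra hne
      refine hg (b.ulim_avg_eq_zero hℓ hω T ?_)
      simpa using hne))

theorem avgMap_coeff (T : UniformRoe b.Carrier) (g : Γ) :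
    (b.avgMap hℓ hω T).coeff g = ulim ω fun n => b.avg n T g := rfl

theorem avgMap_sub (S T : UniformRoe b.Carrier) :
    b.avgMap hℓ hω (S - T) = b.avgMap hℓ hω S - b.avgMap hℓ hω T := by
  ext g
  rw [MonoidAlgebra.coeff_sub, Finsupp.sub_apply, avgMap_coeff, avgMap_coeff, avgMap_coeff]
  simp only [avg_sub]
  exact ulim_eq ((b.tendsto_avg ω S g).sub (b.tendsto_avg ω T g))

theorem avgMap_star (T : UniformRoe b.Carrier) :
    b.avgMap hℓ hω (star T) = star (b.avgMap hℓ hω T) := by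
  ext g
  rw [star_coeff, avgMap_coeff, avgMap_coeff]
  simp only [avg_star]
  exact ulim_eq ((Complex.continuous_conj.tendsto _).comp (b.tendsto_avg ω T g⁻¹))

theorem map_avgMap {A : Type*} [Ring A] [Algebra ℂ A] (π : MonoidAlgebra ℂ Γ →ₐ[ℂ] A)
    (T : UniformRoe b.Carrier) : π (b.avgMap hℓ hω T) =
      ∑ g ∈ (hℓ ((b.lengthMetric ℓ).prop T).toReal).toFinset,
        ulim ω (fun n => b.avg n T g) • π (MonoidAlgebra.of ℂ Γ g) := by
  have h : b.avgMap hℓ hω T = ∑ g ∈ (hℓ ((b.lengthMetric ℓ).prop T).toReal).toFinset,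
      ulim ω (fun n => b.avg n T g) • MonoidAlgebra.of ℂ Γ g := by
    classical
    ext h
    rw [avgMap_coeff, MonoidAlgebra.coeff_sum, Finsupp.finsetSum_apply]
    simp only [MonoidAlgebra.coeff_smul, Finsupp.smul_apply, MonoidAlgebra.of_apply,
      MonoidAlgebra.coeff_single, Finsupp.single_apply, smul_eq_mul, mul_ite, mul_one, mul_zero,
      Finset.sum_ite_eq']
    split_ifs with hh
    · rfl
    · refine b.ulim_avg_eq_zero hℓ hω T ?_
      simpa using hh
  rw [h, map_sum]
  exact Finset.sum_congr rfl fun g _ => map_smul π _ _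

end Disp

end BoxSpace

/-! ## Operator matrices -/

section MatOp

variable {ι : Type w} [Fintype ι] {B : BanachSp.{u}}

/-- The operator on a finite `ℓ²`-sum with a given matrix of operators. -/
def matOp (m : ι → ι → B.Op) :
    (PiLp 2 fun _ : ι => B.carrier) →L[ℂ] (PiLp 2 fun _ : ι => B.carrier) :=
  let e := PiLp.continuousLinearEquiv 2 ℂ fun _ : ι => B.carrier
  (e.symm : (ι → B.carrier) →L[ℂ] PiLp 2 fun _ : ι => B.carrier).comp
    ((ContinuousLinearMap.pi fun x => ∑ y, (m x y).comp (ContinuousLinearMap.proj y)).comp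
      (e : (PiLp 2 fun _ : ι => B.carrier) →L[ℂ] (ι → B.carrier)))

theorem matOp_apply (m : ι → ι → B.Op) (f : PiLp 2 fun _ : ι => B.carrier) (x : ι) :
    matOp m f x = ∑ y, m x y (f y) := by
  simp [matOp]

theorem matOp_mul (m m' : ι → ι → B.Op) :
    matOp m * matOp m' = matOp fun x z => ∑ y, m x y * m' y z := by
  ext f x
  rw [mul_apply_eq_comp, matOp_apply, matOp_apply]
  simp only [matOp_apply, map_sum, sum_apply, mul_apply_eq_comp]
  exact Finset.sum_comm

theorem matOp_one [DecidableEq ι] : matOp (fun x y : ι => if x = y then (1 : B.Op) else 0) = 1 := by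
  ext f x
  rw [matOp_apply, Finset.sum_eq_single x]
  · simp
  · intro y _ hy
    simp [Ne.symm hy]
  · simp

/-- A matrix with at most one nonzero entry in each row and column is bounded by its largest
entry. -/
theorem norm_matOp_le {m : ι → ι → B.Op} (row : ∀ x y y', m x y ≠ 0 → m x y' ≠ 0 → y = y')
    (column : ∀ x x' y, m x y ≠ 0 → m x' y ≠ 0 → x = x') {C : ℝ} (hC0 : 0 ≤ C)
    (hC : ∀ x y, m x y ≠ 0 → ‖m x y‖ ≤ C) : ‖matOp m‖ ≤ C := by
  classical
  refine ContinuousLinearMap.opNorm_le_bound _ hC0 fun f => ?_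
  refine le_of_sq_le_sq ?_ (by positivity)
  rw [mul_pow, PiLp.norm_sq_eq_of_L2, PiLp.norm_sq_eq_of_L2]
  -- With at most one nonzero term per row, the squared norm of the sum is bounded termwise. After
  -- exchanging sums, the column condition counts each `‖f y‖ ^ 2` at most once.
  have h1 : ∀ x, ‖matOp m f x‖ ^ 2 ≤ ∑ y, if m x y ≠ 0 then C ^ 2 * ‖f y‖ ^ 2 else 0 := by
    intro x
    rw [matOp_apply]
    by_cases hx : ∃ y, m x y ≠ 0
    · obtain ⟨y, hy⟩ := hx
      have h0 : ∀ y', y' ≠ y → m x y' = 0 := fun y' hne => by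
        by_contra h
        exact hne (row x y' y h hy)
      rw [Finset.sum_eq_single y (fun y' _ hne => by rw [h0 y' hne]; rfl) (by simp),
        Finset.sum_eq_single y (fun y' _ hne => by rw [h0 y' hne]; simp) (by simp), if_pos hy,
        ← mul_pow]
      gcongr
      exact (m x y).le_of_opNorm_le (hC x y hy) _
    · have h0 : ∀ y, m x y = 0 := fun y => by_contra fun h => hx ⟨y, h⟩
      simp [h0]
  refine (Finset.sum_le_sum fun x _ => h1 x).trans ?_
  rw [Finset.sum_comm, Finset.mul_sum]
  refine Finset.sum_le_sum fun y _ => ?_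
  by_cases hy : ∃ x, m x y ≠ 0
  · obtain ⟨x, hx⟩ := hy
    have h0 : ∀ x', x' ≠ x → ¬ m x' y ≠ 0 := fun x' hne h => hne (column x' x y h hx)
    rw [Finset.sum_eq_single x (fun x' _ hne => if_neg (h0 x' hne)) (by simp), if_pos hx]
  · rw [Finset.sum_eq_zero fun x _ => if_neg fun h => hy ⟨x, h⟩]
    positivity

end MatOp

/-! ## The twisted representation -/

namespace BoxSpace

variable {Γ : Type v} [Group Γ] (b : BoxSpace Γ) {ℓ : LengthFunction Γ}
  (hℓ : ∀ R : ℝ, {g : Γ | ℓ g ≤ R}.Finite) {B : BanachSp.{u}} (π : MonoidAlgebra ℂ Γ →ₐ[ℂ] B.Op)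

/-- The matrix `T`, twisted by the values of a representation at the displacements, on the `n`-th
component. -/
def twist (n : ℕ) : UniformRoe b.Carrier →ₗ[ℂ]
    ((PiLp 2 fun _ : b.Comp n => B.carrier) →L[ℂ] (PiLp 2 fun _ : b.Comp n => B.carrier)) where
  toFun T := matOp fun x y =>
    entry T.1 (b.incl x) (b.incl y) • π (MonoidAlgebra.of ℂ Γ (b.disp hℓ x y))
  map_add' S T := by
    ext f x
    rw [add_apply, PiLp.add_apply, matOp_apply, matOp_apply, matOp_apply, ← Finset.sum_add_distrib]
    refine Finset.sum_congr rfl fun y _ => ?_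
    rw [entry_add, add_smul, add_apply]
  map_smul' z T := by
    ext f x
    rw [RingHom.id_apply, smul_apply, PiLp.smul_apply, matOp_apply, matOp_apply, Finset.smul_sum]
    refine Finset.sum_congr rfl fun y _ => ?_
    rw [entry_smul, mul_smul, smul_apply]

theorem twist_apply (n : ℕ) (T : UniformRoe b.Carrier) (f : PiLp 2 fun _ : b.Comp n => B.carrier)
    (x : b.Comp n) : b.twist hℓ π n T f x = ∑ y, entry T.1 (b.incl x) (b.incl y) •
      π (MonoidAlgebra.of ℂ Γ (b.disp hℓ x y)) (f y) := matOp_apply _ f x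

/-- The displacement from `x` to itself has length `0`; it must be the identity for the diagonal to
be untwisted. -/
theorem twist_one (hone : ∀ g, ℓ g = 0 → g = 1) (n : ℕ) : b.twist hℓ π n 1 = 1 := by
  classical
  rw [← matOp_one]
  change matOp _ = _
  congr 1
  funext x y
  rw [entry_one]
  by_cases h : x = y
  · rw [h, if_pos rfl, if_pos rfl, b.disp_self hℓ hone, map_one, map_one, one_smul]
  · rw [if_neg h, if_neg fun h' => h (b.incl_injective n h'), zero_smul]

/-- Displacements are not multiplicative in general. Only pairs in the supports of `S` and `T`
matter, and there the product of displacements has length at most the sum of the two propagations,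
so for large `n` it is the displacement of the composite. -/
theorem eventually_twist_mul (S T : UniformRoe b.Carrier) :
    ∀ᶠ n in Filter.atTop, b.twist hℓ π n (S * T) = b.twist hℓ π n S * b.twist hℓ π n T := by
  filter_upwards [b.eventually_disp_eq hℓ (((b.lengthMetric ℓ).prop S).toReal +
    ((b.lengthMetric ℓ).prop T).toReal)] with n hn
  change matOp _ = matOp _ * matOp _
  rw [matOp_mul]
  congr 1
  funext x z
  rw [entry_mul_incl, Finset.sum_smul]
  refine Finset.sum_congr rfl fun y _ => ?_
  by_cases hS : entry S.1 (b.incl x) (b.incl y) = 0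
  · rw [hS, zero_mul, zero_smul, zero_smul, zero_mul]
  by_cases hT : entry T.1 (b.incl y) (b.incl z) = 0
  · rw [hT, mul_zero, zero_smul, zero_smul, mul_zero]
  rw [hn x z (b.disp hℓ x y * b.disp hℓ y z) (by rw [mul_smul, disp_smul, disp_smul])
    ((ℓ.map_mul_le _ _).trans (add_le_add (b.disp_le_prop hℓ hS) (b.disp_le_prop hℓ hT))),
    map_mul, map_mul, smul_mul_smul_comm]

variable {π} {s c : ℝ} (hs : 0 < s) (hc : 0 < c)
  (hπ : ∀ g : Γ, ‖π (MonoidAlgebra.of ℂ Γ g)‖ ≤ c * Real.exp (s * ℓ g))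

include hs hc hπ

/-- Each row and column has at most one nonzero entry, so the norm is controlled by the largest one;
displacements are no longer than the propagation, so `s` and `c` do not change. -/
theorem norm_twist_le {W : UniformRoe b.Carrier}
    (row : ∀ x y y', entry W.1 x y ≠ 0 → entry W.1 x y' ≠ 0 → y = y')
    (column : ∀ x x' y, entry W.1 x y ≠ 0 → entry W.1 x' y ≠ 0 → x = x')
    {M : ℝ} (hM0 : 0 ≤ M) (hM : ∀ x y, ‖entry W.1 x y‖ ≤ M) (n : ℕ) :
    ‖b.twist hℓ π n W‖ ≤ M * (c * Real.exp (s * ((b.lengthMetric ℓ).prop W).toReal)) := by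
  refine norm_matOp_le (fun x y y' h h' => ?_) (fun x x' y h h' => ?_) (by positivity)
    fun x y h => ?_
  · exact b.incl_injective n (row _ _ _ (left_ne_zero_of_smul h) (left_ne_zero_of_smul h'))
  · exact b.incl_injective n (column _ _ _ (left_ne_zero_of_smul h) (left_ne_zero_of_smul h'))
  · rw [norm_smul]
    refine mul_le_mul (hM _ _) ((hπ _).trans ?_) (norm_nonneg _) hM0
    have := b.disp_le_prop hℓ (left_ne_zero_of_smul h)
    gcongr

theorem norm_twist_diagonal_le (f : b.Carrier → ℂ) (M : ℝ) (hf : ∀ x, ‖f x‖ ≤ M) (n : ℕ) :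
    ‖b.twist hℓ π n (diagonal f ⟨M, hf⟩)‖ ≤ c * M := by
  classical
  have h : ∀ x y, entry (diagonal f ⟨M, hf⟩).1 x y ≠ 0 → x = y := fun x y hxy => by
    by_contra hne
    exact hxy (by rw [entry_diagonal, if_neg hne])
  have hM0 : 0 ≤ M := (norm_nonneg _).trans (hf (b.pt 0 1))
  refine (b.norm_twist_le hℓ hs hc hπ (fun x y y' h1 h2 => (h _ _ h1).symm.trans (h _ _ h2))
    (fun x x' y h1 h2 => (h _ _ h1).trans (h _ _ h2).symm) hM0 (fun x y => ?_) n).trans_eq ?_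
  · rw [entry_diagonal]
    split_ifs
    · exact hf x
    · simpa using hM0
  · have h0 : (b.lengthMetric ℓ).prop (diagonal f ⟨M, hf⟩) = 0 := by
      refine le_antisymm (FinerMetric.prop_le fun x y hxy => ?_) bot_le
      rw [h x y hxy, (b.lengthMetric ℓ).metric.edist_self]
    rw [h0]
    simp [mul_comm]

theorem norm_twist_partialTranslation_le {V : UniformRoe b.Carrier} (hV : IsPartialTranslation V)
    (n : ℕ) :
    ‖b.twist hℓ π n V‖ ≤ c * Real.exp (s * ((b.lengthMetric ℓ).prop V).toReal) := by
  refine (b.norm_twist_le hℓ hs hc hπ hV.row hV.column zero_le_one (fun x y => ?_) n).trans_eq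
    (one_mul _)
  rcases hV.zero_or_one x y with h | h <;> simp [h]

/-- The twist is multiplicative only eventually, so the summands `f V` are not split: each still has
at most one nonzero entry per row and column, and `norm_twist_le` applies to it for every `n`. -/
theorem exists_norm_twist_le (T : UniformRoe b.Carrier) : ∃ C, ∀ n, ‖b.twist hℓ π n T‖ ≤ C := by
  obtain ⟨k, f, M, hM, hf, V, hV, hT⟩ := exists_decomposition T
  refine ⟨∑ i, M * (c * Real.exp (s * ((b.lengthMetric ℓ).prop
    (diagonal (f i) ⟨M, hf i⟩ * V i)).toReal)), fun n => ?_⟩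
  rw [hT, map_sum]
  refine norm_sum_le_of_le _ fun i _ =>
    b.norm_twist_le hℓ hs hc hπ (fun x y y' h h' => ?_) (fun x x' y h h' => ?_) hM.le
      (fun x y => ?_) n
  · rw [entry_diagonal_mul] at h h'
    exact (hV i).row _ _ _ (right_ne_zero_of_mul h) (right_ne_zero_of_mul h')
  · rw [entry_diagonal_mul] at h h'
    exact (hV i).column _ _ _ (right_ne_zero_of_mul h) (right_ne_zero_of_mul h')
  · rw [entry_diagonal_mul, norm_mul]
    rcases (hV i).zero_or_one x y with h | h
    · simp [h, hM.le]
    · simpa [h] using hf i x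

end BoxSpace

/-! ## Constant vectors and means on finite `ℓ²`-sums -/

section Mean

variable {ι : Type w} [Fintype ι] {B : BanachSp.{u}}

variable (ι) in
/-- The inverse of the norm of the constant function `1`. -/
def constScale : ℂ := ((√(Fintype.card ι))⁻¹ : ℝ)

theorem norm_constScale : ‖constScale ι‖ = (√(Fintype.card ι))⁻¹ := by
  rw [constScale, Complex.norm_real, Real.norm_of_nonneg (by positivity)]

theorem constScale_mul_self : constScale ι * constScale ι = (Fintype.card ι : ℂ)⁻¹ := by
  rw [constScale, ← Complex.ofReal_mul, ← mul_inv, Real.mul_self_sqrt (by positivity)]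
  simp

variable (ι) in
/-- The normalized constant vectors. -/
def constVec (v : B.carrier) : PiLp 2 fun _ : ι => B.carrier :=
  WithLp.toLp 2 fun _ => constScale ι • v

theorem constVec_apply (v : B.carrier) (x : ι) : constVec ι v x = constScale ι • v := rfl

theorem norm_constVec_le (v : B.carrier) : ‖constVec ι v‖ ≤ ‖v‖ := by
  refine le_of_sq_le_sq ?_ (norm_nonneg v)
  rw [PiLp.norm_sq_eq_of_L2]
  simp only [constVec_apply, norm_smul, norm_constScale, Finset.sum_const, Finset.card_univ,
    nsmul_eq_mul, mul_pow, inv_pow]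
  rw [Real.sq_sqrt (by positivity), ← mul_assoc]
  exact mul_le_of_le_one_left (sq_nonneg _) mul_inv_le_one

variable (ι) in
/-- The normalized sum of the values of a functional. -/
def meanFun (φ : StrongDual ℂ B.carrier) : StrongDual ℂ (PiLp 2 fun _ : ι => B.carrier) :=
  (constScale ι) • ∑ x, φ.comp (PiLp.proj 2 (fun _ : ι => B.carrier) x)

theorem meanFun_apply (φ : StrongDual ℂ B.carrier) (f : PiLp 2 fun _ : ι => B.carrier) :
    meanFun ι φ f = constScale ι * φ (∑ x, f x) := by
  simp [meanFun]

theorem norm_meanFun_le (φ : StrongDual ℂ B.carrier) : ‖meanFun ι φ‖ ≤ ‖φ‖ := by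
  refine ContinuousLinearMap.opNorm_le_bound _ (norm_nonneg _) fun f => ?_
  rw [meanFun_apply, norm_mul, norm_constScale]
  have h1 : ‖∑ x, f x‖ ≤ √(Fintype.card ι) * ‖f‖ := by
    refine (norm_sum_le _ _).trans (le_of_sq_le_sq ?_ (by positivity))
    rw [mul_pow, Real.sq_sqrt (by positivity), PiLp.norm_sq_eq_of_L2]
    exact sq_sum_le_card_mul_sum_sq
  calc (√(Fintype.card ι))⁻¹ * ‖φ (∑ x, f x)‖
      ≤ (√(Fintype.card ι))⁻¹ * (‖φ‖ * (√(Fintype.card ι) * ‖f‖)) := by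
        gcongr
        exact φ.le_opNorm_of_le h1
    _ = ((√(Fintype.card ι))⁻¹ * √(Fintype.card ι)) * (‖φ‖ * ‖f‖) := by ring
    _ ≤ ‖φ‖ * ‖f‖ := mul_le_of_le_one_left (by positivity) inv_mul_le_one

theorem meanFun_constVec [Nonempty ι] (φ : StrongDual ℂ B.carrier) (v : B.carrier) :
    meanFun ι φ (constVec ι v) = φ v := by
  have h : (Fintype.card ι : ℂ) ≠ 0 := Nat.cast_ne_zero.2 Fintype.card_ne_zero
  rw [meanFun_apply]
  simp only [constVec_apply, Finset.sum_const, Finset.card_univ, map_nsmul, map_smul,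
    nsmul_eq_mul, smul_eq_mul]
  rw [mul_left_comm, ← mul_assoc (constScale ι), constScale_mul_self, mul_inv_cancel_left₀ h]

end Mean

/-! ### The twisted representation on an ultraproduct. -/

namespace BoxSpace

variable {Γ : Type v} [Group Γ] (b : BoxSpace Γ) {ℓ : LengthFunction Γ}
  (hℓ : ∀ R : ℝ, {g : Γ | ℓ g ≤ R}.Finite) {B : BanachSp.{u}} (π : MonoidAlgebra ℂ Γ →ₐ[ℂ] B.Op)

theorem eventually_twist_transl (g : Γ) : ∀ᶠ n in Filter.atTop,
    ∀ (f : PiLp 2 fun _ : b.Comp n => B.carrier) (x : b.Comp n),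
      b.twist hℓ π n (b.transl g) f x = π (MonoidAlgebra.of ℂ Γ g) (f (g⁻¹ • x)) := by
  classical
  filter_upwards [b.eventually_disp_eq hℓ (ℓ g)] with n hn f x
  rw [twist_apply, Finset.sum_eq_single (g⁻¹ • x)]
  · rw [hn x (g⁻¹ • x) g (smul_inv_smul g x) le_rfl, entry_transl, smul_incl, smul_inv_smul,
      if_pos rfl, one_smul]
  · intro y _ hy
    rw [entry_transl, if_neg, zero_smul]
    rw [smul_incl]
    intro h
    exact hy (eq_inv_smul_iff.2 (b.incl_injective n h).symm)
  · simp

theorem eventually_meanFun_twist_transl (φ : StrongDual ℂ B.carrier) (g : Γ) :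
    ∀ᶠ n in Filter.atTop, ∀ f : PiLp 2 fun _ : b.Comp n => B.carrier,
      meanFun _ φ (b.twist hℓ π n (b.transl g) f) =
        meanFun _ (φ.comp (π (MonoidAlgebra.of ℂ Γ g))) f := by
  filter_upwards [b.eventually_twist_transl hℓ π g] with n hn f
  rw [meanFun_apply, meanFun_apply]
  simp only [hn]
  rw [ContinuousLinearMap.comp_apply, map_sum (π _)]
  congr 2
  exact Fintype.sum_equiv (MulAction.toPerm g⁻¹) _ _ fun x => rfl

theorem eventually_twist_transl_constVec {v : B.carrier} (hv : v ∈ groupInvariants B π) (g : Γ) :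
    ∀ᶠ n in Filter.atTop, b.twist hℓ π n (b.transl g) (constVec _ v) = constVec _ v := by
  filter_upwards [b.eventually_twist_transl hℓ π g] with n hn
  ext x
  rw [hn, constVec_apply, map_smul, hv g, constVec_apply]

/-- The two normalisations combine to `1 / |Γ / Nₙ|`. For large `n` each nonzero entry `(x, y)` lies
on the diagonal `x = g • y` of exactly one `g` in the ball, its displacement, so the double sum
regroups into diagonal averages. -/
theorem eventually_meanFun_twist_constVec (φ : StrongDual ℂ B.carrier) (T : UniformRoe b.Carrier)
    (v : B.carrier) : ∀ᶠ n in Filter.atTop,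
      meanFun _ φ (b.twist hℓ π n T (constVec _ v)) =
        ∑ g ∈ (hℓ ((b.lengthMetric ℓ).prop T).toReal).toFinset,
          b.avg n T g * φ (π (MonoidAlgebra.of ℂ Γ g) v) := by
  classical
  set F := (hℓ ((b.lengthMetric ℓ).prop T).toReal).toFinset with hF
  have hmem : ∀ g, g ∈ F ↔ ℓ g ≤ ((b.lengthMetric ℓ).prop T).toReal := fun g => by simp [hF]
  filter_upwards [b.eventually_disp_eq hℓ ((b.lengthMetric ℓ).prop T).toReal] with n hn
  have key : ∀ x y : b.Comp n,
      entry T.1 (b.incl x) (b.incl y) * φ (π (MonoidAlgebra.of ℂ Γ (b.disp hℓ x y)) v) =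
        ∑ g ∈ F, if g • y = x then
          entry T.1 (b.incl (g • y)) (b.incl y) * φ (π (MonoidAlgebra.of ℂ Γ g) v) else 0 := by
    intro x y
    by_cases h0 : entry T.1 (b.incl x) (b.incl y) = 0
    · rw [h0, zero_mul, Finset.sum_eq_zero]
      intro g _
      split_ifs with h
      · rw [h, h0, zero_mul]
      · rfl
    · rw [Finset.sum_eq_single_of_mem (b.disp hℓ x y) ((hmem _).2 (b.disp_le_prop hℓ h0)),
        disp_smul, if_pos rfl]
      intro g hg hne
      exact if_neg fun h => hne (hn x y g h ((hmem g).1 hg)).symm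
  have h1 : meanFun _ φ (b.twist hℓ π n T (constVec _ v)) = (Fintype.card (b.Comp n) : ℂ)⁻¹ *
      ∑ x : b.Comp n, ∑ y : b.Comp n, entry T.1 (b.incl x) (b.incl y) *
        φ (π (MonoidAlgebra.of ℂ Γ (b.disp hℓ x y)) v) := by
    rw [meanFun_apply, ← constScale_mul_self, mul_assoc, map_sum]
    congr 1
    rw [Finset.mul_sum]
    refine Finset.sum_congr rfl fun x _ => ?_
    rw [twist_apply, map_sum, Finset.mul_sum]
    refine Finset.sum_congr rfl fun y _ => ?_
    rw [constVec_apply, map_smul, map_smul, map_smul, smul_eq_mul, smul_eq_mul]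
    ring
  rw [h1]
  simp only [key, avg]
  rw [Finset.sum_comm, Finset.sum_congr rfl fun y _ => Finset.sum_comm, Finset.sum_comm,
    Finset.mul_sum]
  refine Finset.sum_congr rfl fun g _ => ?_
  rw [mul_assoc, Finset.sum_mul]
  congr 1
  refine Finset.sum_congr rfl fun y _ => ?_
  rw [Finset.sum_ite_eq, if_pos (Finset.mem_univ _)]

/-- A representation of `Γ` with small growth induces a representation of the Roe algebra on an
ultraproduct of finite `ℓ²`-sums, together with constant vectors and means that relate it to the
given representation through the averaging map. -/
theorem exists_twisted_rep {𝔅 : Set BanachSp.{u}} (hultra : ClosedUnderUltraproducts 𝔅)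
    (hL2 : ClosedUnderL2 𝔅) (hone : ∀ g, ℓ g = 0 → g = 1) {ω : Ultrafilter ℕ}
    (hω : (ω : Filter ℕ) ≤ Filter.atTop) {s c : ℝ} (hs : 0 < s) (hc : 0 < c)
    (hπ : (groupReps 𝔅 ℓ s c).Mem B π) :
    ∃ (C : BanachSp.{u}) (ρ : UniformRoe b.Carrier →ₐ[ℂ] C.Op)
      (J : B.carrier → C.carrier) (m : StrongDual ℂ B.carrier → StrongDual ℂ C.carrier),
      (roeReps 𝔅 (b.lengthMetric ℓ) s c).Mem C ρ ∧ (∀ v, ‖J v‖ ≤ ‖v‖) ∧ (∀ φ, ‖m φ‖ ≤ ‖φ‖) ∧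
      (∀ φ v, m φ (J v) = φ v) ∧
      (∀ φ T v, m φ (ρ T (J v)) = φ (π (b.avgMap hℓ hω T) v)) ∧
      (∀ φ g η, m φ (ρ (b.transl g) η) = m (φ.comp (π (MonoidAlgebra.of ℂ Γ g))) η) ∧
      ∀ v ∈ groupInvariants B π, J v ∈ roeInvariants C ρ := by
  choose E hE e using fun n => hL2.exists_piLp hπ.1 (b.Comp n)
  replace e := fun n => (e n).some
  -- An ultrafilter finer than `atTop` contains `{k | n < k}` and so is not principal at `n`.
  have hωn : ∀ n : ℕ, ω ≠ pure n := by
    rintro n rfl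
    have h1 := hω (Filter.eventually_gt_atTop n)
    exact lt_irrefl n h1
  obtain ⟨C, hC, ⟨f⟩⟩ := hultra E hE ω hωn
  let σ : ∀ n, UniformRoe b.Carrier →ₗ[ℂ] (E n).Op := fun n =>
    (conjOp (e n)).toLinearMap.comp (b.twist hℓ π n)
  have hσ : ∀ n T ξ, σ n T ξ = (e n).symm (b.twist hℓ π n T (e n ξ)) := fun n T ξ => rfl
  have hσn : ∀ n T, ‖σ n T‖ ≤ ‖b.twist hℓ π n T‖ := fun n T => norm_conjOp_le _ _
  have hb : ∀ T, ∃ K, ∀ n, ‖σ n T‖ ≤ K := fun T => by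
    obtain ⟨K, hK⟩ := b.exists_norm_twist_le hℓ hs hc hπ.2 T
    exact ⟨K, fun n => (hσn n T).trans (hK n)⟩
  let ρ₀ := ultraRep ω σ hb
    (.of_forall fun n => by
      change conjOp (e n) (b.twist hℓ π n 1) = 1
      rw [b.twist_one hℓ π hone, map_one])
    (fun S T => ((b.eventually_twist_mul hℓ π S T).filter_mono hω).mono fun n hn => by
      change conjOp (e n) (b.twist hℓ π n (S * T)) = _
      rw [hn, map_mul]
      rfl)
  have hρ₀ : ∀ T ξ, ρ₀ T (Submodule.Quotient.mk ξ) =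
    Submodule.Quotient.mk (lpOp (fun n => σ n T) (hb T) ξ) := fun T ξ => rfl
  let ρ : UniformRoe b.Carrier →ₐ[ℂ] C.Op := (conjOp f).comp ρ₀
  have hρ : ∀ T η, ρ T η = f.symm (ρ₀ T (f η)) := fun T η => rfl
  have hρn : ∀ T (K : ℝ), 0 ≤ K → (∀ n, ‖b.twist hℓ π n T‖ ≤ K) → ‖ρ T‖ ≤ K := fun T K hK h =>
    (norm_conjOp_le _ _).trans (norm_ultraOp_le hK fun n => (hσn n T).trans (h n))
  let J₀ : B.carrier → lp (fun n => (E n).carrier) ∞ := fun v =>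
    ⟨fun n => (e n).symm (constVec _ v), memℓp_infty ⟨‖v‖, by
      rintro _ ⟨n, rfl⟩
      change ‖(e n).symm (constVec _ v)‖ ≤ _
      rw [LinearIsometryEquiv.norm_map]
      exact norm_constVec_le v⟩⟩
  have hJ₀ : ∀ v n, J₀ v n = (e n).symm (constVec _ v) := fun v n => rfl
  let J : B.carrier → C.carrier := fun v => f.symm (Submodule.Quotient.mk (J₀ v))
  have hm₀ : ∀ (φ : StrongDual ℂ B.carrier) (n : ℕ),
      ‖(meanFun (b.Comp n) φ).comp ((e n).toContinuousLinearEquiv :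
        (E n).carrier →L[ℂ] PiLp 2 fun _ : b.Comp n => B.carrier)‖ ≤ ‖φ‖ := fun φ n => by
    refine ContinuousLinearMap.opNorm_le_bound _ (norm_nonneg _) fun ξ => ?_
    rw [← (e n).norm_map ξ]
    exact (meanFun (b.Comp n) φ).le_of_opNorm_le (norm_meanFun_le φ) (e n ξ)
  let m₀ : StrongDual ℂ B.carrier → StrongDual ℂ (Ultraproduct E ω) := fun φ =>
    ultraFunctional ω _ ‖φ‖ (hm₀ φ)
  have hm₀_mk : ∀ φ (ξ : lp (fun n => (E n).carrier) ∞), m₀ φ (Submodule.Quotient.mk ξ) =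
    ulim ω fun n => meanFun (b.Comp n) φ (e n (ξ n)) := fun φ ξ => rfl
  let m : StrongDual ℂ B.carrier → StrongDual ℂ C.carrier := fun φ =>
    (m₀ φ).comp (f.toContinuousLinearEquiv : C.carrier →L[ℂ] Ultraproduct E ω)
  have hm : ∀ φ η, m φ η = m₀ φ (f η) := fun φ η => rfl
  refine ⟨C, ρ, J, m, ⟨hC, ⟨c, fun h M hh => ?_⟩, fun V hV => ?_⟩, fun v => ?_, fun φ => ?_,
    fun φ v => ?_, fun φ T v => ?_, fun φ g η => ?_, fun v hv => ?_⟩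
  · have hM0 : 0 ≤ M := (norm_nonneg _).trans (hh (b.pt 0 1))
    exact hρn _ _ (by positivity) (b.norm_twist_diagonal_le hℓ hs hc hπ.2 h M hh)
  · exact hρn _ _ (by positivity) (b.norm_twist_partialTranslation_le hℓ hs hc hπ.2 hV)
  · change ‖f.symm _‖ ≤ _
    rw [LinearIsometryEquiv.norm_map]
    refine (Submodule.Quotient.norm_mk_le _ _).trans
      (lp.norm_le_of_forall_le (norm_nonneg v) fun n => ?_)
    rw [hJ₀, LinearIsometryEquiv.norm_map]
    exact norm_constVec_le v
  · refine ContinuousLinearMap.opNorm_le_bound _ (norm_nonneg _) fun η => ?_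
    rw [hm, ← f.norm_map η]
    exact (m₀ φ).le_of_opNorm_le (norm_ultraFunctional_le _ _ _) _
  · rw [hm, LinearIsometryEquiv.apply_symm_apply, hm₀_mk]
    refine ulim_eq (tendsto_const_nhds.congr fun n => ?_)
    rw [hJ₀, LinearIsometryEquiv.apply_symm_apply, meanFun_constVec]
  · rw [hm, hρ, LinearIsometryEquiv.apply_symm_apply, LinearIsometryEquiv.apply_symm_apply, hρ₀,
      hm₀_mk, map_avgMap, sum_apply, map_sum]
    have hlim : Filter.Tendsto (fun n => ∑ g ∈ (hℓ ((b.lengthMetric ℓ).prop T).toReal).toFinset,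
        b.avg n T g * φ (π (MonoidAlgebra.of ℂ Γ g) v)) ω
        (nhds (∑ g ∈ (hℓ ((b.lengthMetric ℓ).prop T).toReal).toFinset,
          φ ((ulim ω (fun n => b.avg n T g) • π (MonoidAlgebra.of ℂ Γ g)) v))) := by
      refine tendsto_finsetSum _ fun g _ => ?_
      rw [smul_apply, map_smul, smul_eq_mul]
      exact (b.tendsto_avg ω T g).mul_const _
    refine ulim_eq (hlim.congr' (((b.eventually_meanFun_twist_constVec hℓ π φ T
      v).filter_mono hω).mono fun n hn => ?_))
    change _ = meanFun _ φ (e n ((e n).symm (b.twist hℓ π n T (e n ((e n).symm (constVec _ v))))))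
    rw [LinearIsometryEquiv.apply_symm_apply, LinearIsometryEquiv.apply_symm_apply, hn]
  · obtain ⟨ξ, hξ⟩ := Submodule.Quotient.mk_surjective _ (f η)
    obtain ⟨K, hK⟩ : ∃ K, ∀ n, ‖meanFun (b.Comp n) (φ.comp (π (MonoidAlgebra.of ℂ Γ g)))
        (e n (ξ n))‖ ≤ K := ⟨_, fun n => ((meanFun (b.Comp n) _).le_of_opNorm_le_of_le
          (norm_meanFun_le _) (((e n).norm_map _).le.trans
            (lp.norm_apply_le_norm ENNReal.top_ne_zero ξ n)))⟩
    rw [hm, hm, hρ, LinearIsometryEquiv.apply_symm_apply, ← hξ, hρ₀, hm₀_mk, hm₀_mk]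
    refine ulim_eq ((tendsto_ulim ω hK).congr' (((b.eventually_meanFun_twist_transl hℓ π φ
      g).filter_mono hω).mono fun n hn => ?_))
    change _ = meanFun _ φ (e n ((e n).symm (b.twist hℓ π n (b.transl g) (e n (ξ n)))))
    rw [LinearIsometryEquiv.apply_symm_apply, hn]
  -- It suffices to test translations, for which the constant vectors over a fixed vector are fixed
  -- once `n` is large.
  · rw [b.roeInvariants_eq]
    intro g
    rw [AlgHom.comp_apply, translHom_of, hρ, LinearIsometryEquiv.apply_symm_apply, hρ₀]
    refine congrArg f.symm (ultraproduct_mk_eq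
      (((b.eventually_twist_transl_constVec hℓ π hv g).filter_mono hω).mono fun n hn => ?_))
    rw [lpOp_apply, hσ, hJ₀, LinearIsometryEquiv.apply_symm_apply, hn]

end BoxSpace

/-! ### From one box space to the group. -/

namespace LengthFunction

variable {Γ : Type v} [Group Γ]

/-- The sum of two length functions. -/
def add (ℓ ℓ' : LengthFunction Γ) : LengthFunction Γ where
  toFun g := ℓ g + ℓ' g
  nonneg g := add_nonneg (ℓ.nonneg g) (ℓ'.nonneg g)
  map_one := by rw [ℓ.map_one, ℓ'.map_one, add_zero]
  map_inv g := by rw [ℓ.map_inv, ℓ'.map_inv]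
  map_mul_le g h := by linarith [ℓ.map_mul_le g h, ℓ'.map_mul_le g h]

end LengthFunction

theorem mem_groupReps_of_le {Γ : Type v} [Group Γ] {𝔅 : Set BanachSp.{u}} {ℓ ℓ' : LengthFunction Γ}
    (h : ∀ g, ℓ g ≤ ℓ' g) {s c : ℝ} (hs : 0 < s) (hc : 0 < c) {B : BanachSp.{u}}
    {π : MonoidAlgebra ℂ Γ →ₐ[ℂ] B.Op} (hπ : (groupReps 𝔅 ℓ s c).Mem B π) :
    (groupReps 𝔅 ℓ' s c).Mem B π := by
  refine ⟨hπ.1, fun g => (hπ.2 g).trans ?_⟩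
  have := h g
  gcongr

/-- The projection for the group is the image of the one for the space under the extended averaging
map; the twisted representation attached to each `π` supplies both its continuity and the projection
property. -/
theorem GeometricStrongBanachT.strongBanachT {𝔅 : Set BanachSp.{u}}
    (hdual : ClosedUnderDuality 𝔅) (hconj : ClosedUnderConjugation 𝔅)
    (hultra : ClosedUnderUltraproducts 𝔅) (hL2 : ClosedUnderL2 𝔅) {Γ : Type v} [Group Γ]
    {b : BoxSpace Γ} (h : GeometricStrongBanachT 𝔅 b.lengthMetrics) : StrongBanachT 𝔅 Γ := by
  intro ℓ
  -- An arbitrary `ℓ` need not be proper nor vanish only at the identity. The sum does, and since it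
  -- dominates `ℓ`, growth bounds for `ℓ` imply those for it.
  let ℓ' := ℓ.add b.length
  have hle : ∀ g, ℓ g ≤ ℓ' g := fun g => le_add_of_nonneg_right (b.length.nonneg g)
  have hle' : ∀ g, b.length g ≤ ℓ' g := fun g => le_add_of_nonneg_left (ℓ.nonneg g)
  have hℓ : ∀ R : ℝ, {g : Γ | ℓ' g ≤ R}.Finite := fun R =>
    (b.proper R).subset fun g hg => (hle' g).trans hg
  have hone : ∀ g, ℓ' g = 0 → g = 1 := fun g hg =>
    b.eq_one_of_length_eq_zero g (le_antisymm ((hle' g).trans_eq hg) (b.length.nonneg g))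
  have hω := Nat.hyperfilter_le_atTop
  obtain ⟨s, hs, hp⟩ := h (b.lengthMetric ℓ') ⟨ℓ', rfl⟩
  refine ⟨s, hs, fun c hc => ?_⟩
  obtain ⟨p, hp⟩ := hp c hc
  have hΦ : ∀ T, (groupReps 𝔅 ℓ s c).seminorm (b.avgMap hℓ hω T) ≤
      (roeReps 𝔅 (b.lengthMetric ℓ') s c).seminorm T := by
    intro T
    refine RepClass.seminorm_le _ (RepClass.seminorm_nonneg _ _) fun B π hπ => ?_
    obtain ⟨C, ρ, J, m, hρ, hJ, hm, -, hmρ, -, -⟩ := b.exists_twisted_rep hℓ π hultra hL2 hone hω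
      hs hc (mem_groupReps_of_le hle hs hc hπ)
    refine ContinuousLinearMap.opNorm_le_bound _ (RepClass.seminorm_nonneg _ _) fun v => ?_
    -- Test against functionals: `φ (π (avgMap T) v)` is a matrix coefficient of `ρ T` between
    -- vectors and functionals of no larger norm.
    refine NormedSpace.norm_le_dual_bound ℂ _
      (mul_nonneg (RepClass.seminorm_nonneg _ _) (norm_nonneg _)) fun φ => ?_
    rw [← hmρ, mul_comm]
    exact (m φ).le_of_opNorm_le_of_le (hm φ)
      ((ρ T).le_of_opNorm_le_of_le (RepClass.norm_le _ hρ T) (hJ v))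
  refine ⟨_, hp.map (roeReps_conjDualStable hdual hconj _ s c)
    (groupReps_conjDualStable hdual hconj ℓ s c) (b.avgMap_sub hℓ hω) (b.avgMap_star hℓ hω) hΦ
    fun B π hπ => ?_⟩
  obtain ⟨C, ρ, J, m, hρ, hJ, hm, hmJ, hmρ, hmg, hinv⟩ := b.exists_twisted_rep hℓ π hultra hL2 hone
    hω hs hc (mem_groupReps_of_le hle hs hc hπ)
  have hext : ∀ (φ : StrongDual ℂ B.carrier) (v : B.carrier)
      (a : (roeReps 𝔅 (b.lengthMetric ℓ') s c).Alg),
      m φ ((roeReps 𝔅 (b.lengthMetric ℓ') s c).ext ρ a (J v)) =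
        φ ((groupReps 𝔅 ℓ s c).ext π (RepClass.mapExt _ _ (b.avgMap hℓ hω) a) v) := by
    intro φ v a
    induction a using UniformSpace.Completion.induction_on with
    | hp =>
      refine isClosed_eq ((m φ).continuous.comp ?_) (φ.continuous.comp ?_)
      · exact (RepClass.continuous_ext _ ρ).clm_apply continuous_const
      · exact ((RepClass.continuous_ext _ π).comp (RepClass.continuous_mapExt _)).clm_apply
          continuous_const
    | ih T =>
      rw [RepClass.mapExt_coe (b.avgMap_sub hℓ hω) hΦ, RepClass.ext_coe _ hρ,
        RepClass.ext_coe _ hπ]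
      exact hmρ φ T v
  have hproj := hp.isProj C ρ hρ
  refine ⟨fun v g => ?_, fun v hv => ?_⟩
  · refine (SeparatingDual.eq_iff_forall_dual_eq (R := ℂ)).2 fun φ => ?_
    have h1 := hext (φ.comp (π (MonoidAlgebra.of ℂ Γ g))) v p
    have h2 := hproj.map_mem (J v)
    rw [b.roeInvariants_eq] at h2
    have h3 := h2 g
    rw [AlgHom.comp_apply, b.translHom_of] at h3
    rw [← hmg, h3, hext] at h1
    exact h1.symm
  -- For an invariant `v` the constant vector `J v` is invariant, hence fixed by `ρ(p)`, and `m φ (J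
  -- v) = φ v`.
  · refine (SeparatingDual.eq_iff_forall_dual_eq (R := ℂ)).2 fun φ => ?_
    rw [← hext, hproj.map_id _ (hinv v hv), hmJ]

end GeomT

end

/-! ### The equivalence of the three properties. -/

theorem theorem5p18 (𝔅 : Set GeomT.BanachSp)
    (huc : GeomT.UniformlyConvexFamily 𝔅)
    (hdual : GeomT.ClosedUnderDuality 𝔅)
    (hconj : GeomT.ClosedUnderConjugation 𝔅)
    (hultra : GeomT.ClosedUnderUltraproducts 𝔅)
    (hL2 : GeomT.ClosedUnderL2 𝔅)
    (Γ : Type*) [Group Γ] [Countable Γ] [Group.ResiduallyFinite Γ] :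
    List.TFAE
      [GeomT.StrongBanachT 𝔅 Γ,
        ∀ b : GeomT.BoxSpace Γ, GeomT.GeometricStrongBanachT 𝔅 b.lengthMetrics,
        ∃ b : GeomT.BoxSpace Γ, GeomT.GeometricStrongBanachT 𝔅 b.lengthMetrics] := by
  tfae_have 1 → 2 := fun h b => h.geometricStrongBanachT hdual hconj b
  tfae_have 2 → 3 := fun h => (GeomT.nonempty_boxSpace Γ).elim fun b => ⟨b, h b⟩
  tfae_have 3 → 1 := fun ⟨_, h⟩ => h.strongBanachT hdual hconj hultra hL2
  tfae_finish
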